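/- Theorem 1.6. Let $1\le i<j\le m$ be integers. The Shi arrangement of type D is $$\mathcal D_m=\{\{x_s-x_t=0\},\{x_s-x_t=1\},\{x_s+x_t=0\},\{x_s+x_t=1\}\mid 1\le s<t\le m\}.$$ For $H\in\mathcal D_m$ and a positive integer $q$, let $M((\mathcal D_m^{H})_q)$ denote the complement of the restriction of $\mathcal D_m$ to $H$ over $\mathbb Z/q\mathbb Z$, i.e. the set of points of $(\mathbb Z/q\mathbb Z)^m$ that satisfy the equation of $H$ modulo $q$ and do not satisfy the equation of any other hyperplane $K\in\mathcal D_m\setminus\{H\}$ modulo $q$. Put $T:=q-2m$. Then for all sufficiently large integers $q$: $$|M((\mathcal D_m^{\{x_i-x_j=0\}})_q)|=\begin{cases}(T+3)^{j-i-1}(T+4)^{m-j}\bigl((T+4)^i-(T+3)^{i-1}\bigr)-(T+3)^{m-i-1}(T+4)^{i-1}&\text{if } q \text{ is odd},\\(T+3)^{j-i-1}(T+4)^{i-1}\bigl((T+4)^{m-j+1}-(T+3)^{m-j}\bigr)-(T+3)^{m-i-1}(T+4)^{i-1}&\text{if } q \text{ is even};\end{cases}$$ $$|M((\mathcal D_m^{\{x_i-x_j=1\}})_q)|=(T+2)^{m+i-j}(T+3)^{j-i-1};$$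 $$|M((\mathcal D_m^{\{x_i+x_j=0\}})_q)|=\begin{cases}(T+2)^{m-j}(T+3)^{j-i}\bigl((T+4)^{i-1}-(T+3)^{i-2}\bigr)&\text{if } q \text{ is odd},\\(T+2)^{m-j+1}(T+3)^{j-i-1}(T+4)^{i-1}&\text{if } q \text{ is even};\end{cases}$$ $$|M((\mathcal D_m^{\{x_i+x_j=1\}})_q)|=\begin{cases}(T+2)^{i-1}(T+3)^{j-i}(T+4)^{m-j}-(T+2)^{i-1}(T+3)^{m-i-1}&\text{if } q \text{ is odd},\\(T+2)^{i-1}(T+3)^{j-i-1}\bigl((T+4)^{m-j+1}-(T+3)^{m-j}\bigr)-(T+2)^{i-1}(T+3)^{m-i-1}&\text{if } q \text{ is even}.\end{cases}$$ (For $i=1$ the factor $(T+3)^{i-2}$ is $(T+3)^{-1}$.) -/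

import Mathlib

/-- An affine hyperplane `a₁ x₁ + ⋯ + aₘ xₘ = b` given by integer data. -/
@[ext]
structure IntHyperplane (m : ℕ) where
  /-- the coefficients `a₁, …, aₘ` -/
  coeff : Fin m → ℤ
  /-- the constant `b` -/
  const : ℤ

/-- The reduction `H[q]` of a hyperplane: its set of solutions in `(ℤ/qℤ)^m`. -/
def IntHyperplane.mod {m : ℕ} (H : IntHyperplane m) (q : ℕ) : Set (Fin m → ZMod q) :=
  {x | ∑ k, (H.coeff k : ZMod q) * x k = (H.const : ZMod q)}

/-- The hyperplane `x_s - x_t = c`. -/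
def diffHyperplane {m : ℕ} (s t : Fin m) (c : ℤ) : IntHyperplane m where
  coeff := Pi.single s 1 - Pi.single t 1
  const := c

/-- The hyperplane `x_s + x_t = c`. -/
def sumHyperplane {m : ℕ} (s t : Fin m) (c : ℤ) : IntHyperplane m where
  coeff := Pi.single s 1 + Pi.single t 1
  const := c

/-- The Shi arrangement of type D: all hyperplanes `x_s ± x_t = 0` and `x_s ± x_t = 1`
with `s < t`. -/
def shiD (m : ℕ) : Set (IntHyperplane m) :=
  {H | ∃ s t : Fin m, s < t ∧ ∃ c : ℤ, (c = 0 ∨ c = 1) ∧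
    (H = diffHyperplane s t c ∨ H = sumHyperplane s t c)}

/-- The reduction mod `q` of the restriction `A^H`: the arrangement inside `H[q]` formed by the
intersections `H[q] ∩ K[q]`, where `K` runs over the hyperplanes of `A` other than `H`.
(Empty intersections may occur; they do not affect the complement.) -/
def restrictionMod {m : ℕ} (A : Set (IntHyperplane m)) (H : IntHyperplane m) (q : ℕ) :
    Set (Set (Fin m → ZMod q)) :=
  {S | ∃ K ∈ A, K ≠ H ∧ S = H.mod q ∩ K.mod q}

/-- The complement `M((A^H)_q)`: the points of `H[q]` that lie on no member of the restricted
arrangement. -/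
def restrictionComplement {m : ℕ} (A : Set (IntHyperplane m)) (H : IntHyperplane m) (q : ℕ) :
    Set (Fin m → ZMod q) :=
  H.mod q \ ⋃₀ restrictionMod A H q

/-! The number of points of the restriction is found by sorting coordinates into gaps.

Represent every residue by the integer `u` with `-q/2 < u ≤ q/2`, and regard a coordinate `x_k` as
the label `k` written at the position `|u|` of a half-line, with the sign of `u`; the residue `0`
counts as negative. The four hyperplanes on two coordinates then say that the labels do not share
a position, and that adjacent labels have increasing keys, where the key of `k` is `k` for a
positive sign and `2m - k` for a negative one (`avoidsShi_iff_goodPair`). So every run of adjacent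
labels is sorted, and it is determined by the set of its signed labels: a placement is the same as
an independent choice of a signed gap between unoccupied positions for every label. For a fixed
choice of signs this is the bijection `place_gapIndex`, `gapIndex_place`.

On a hyperplane `H` that involves the coordinates `s < t`, the coordinates `x_s` and `x_t`
together form a block of one or two adjacent positions, in one of two ways that differ by signs
(`ncard_eq_add_of_blockTypes`). The block takes the place of one or two separators of the gaps of
the other labels. The remaining hyperplanes bound the keys of the labels adjacent to the block,
and, gaps being sorted, such a bound on an adjacent label is a bound on all labels of the gap
next to the block (`left_neighbour_iff`, `right_neighbour_iff`). For every separator at which the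
block may begin, the labels choose their gaps independently, so the count is a product; the
number of choices (`BlockData.slotCount`) depends, for interior separators, only on whether the
label is below `s`, between `s` and `t`, or above `t`. Summing over the separators gives the main
terms. The subtracted terms come from those blocks at an end of the half-line, where `2 x_s` or
`2 x_t` is `0` or `1`, that lie on a further hyperplane (`BlockData.ncard_restrictedConfigs`). -/

/-! ### Sorting labels into gaps -/

/-- A placement `p` of labels on the integer line is admissible for the keys `κ` if no position is
used twice and the keys increase along adjacent labels. -/
structure Admissible {L : Type*} (κ p : L → ℤ) : Prop where
  inj : Function.Injective p
  adj : ∀ l l', p l' = p l + 1 → κ l < κ l'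

/-- The number of unoccupied positions below `x`, normalised so that it equals `x` when all
labels lie at or above `x`. -/
def gapIndex {L : Type*} [Fintype L] (p : L → ℤ) (x : ℤ) : ℤ :=
  x - (Finset.univ.filter fun l => p l < x).card

/-- The placement obtained from a choice of gaps `g` by sorting the labels of every gap by key and
writing down the gaps one after the other, with one unoccupied position between two gaps. -/
def place {L : Type*} [Fintype L] (κ g : L → ℤ) (l : L) : ℤ :=
  g l + (Finset.univ.filter fun l' => g l' < g l ∨ g l' = g l ∧ κ l' < κ l).card

/-- The unoccupied position between the gaps `β` and `β + 1`. -/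
def separator {L : Type*} [Fintype L] (g : L → ℤ) (β : ℤ) : ℤ :=
  β + (Finset.univ.filter fun l => g l ≤ β).card

section Line

variable {L : Type*} [Fintype L] {κ p g : L → ℤ}

lemma gapIndex_succ_of_occupied (hp : Function.Injective p) (l : L) :
    gapIndex p (p l + 1) = gapIndex p (p l) := by
  classical
  have : (Finset.univ.filter fun l' => p l' < p l + 1) =
      insert l (Finset.univ.filter fun l' => p l' < p l) := by
    ext l'
    simp only [Finset.mem_filter, Finset.mem_univ, true_and, Finset.mem_insert]
    constructor
    · intro h
      rcases (Int.lt_add_one_iff.1 h).eq_or_lt with h | h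
      · exact Or.inl (hp h)
      · exact Or.inr h
    · rintro (rfl | h) <;> omega
  unfold gapIndex
  rw [this, Finset.card_insert_of_notMem (by simp)]
  push_cast
  ring

lemma gapIndex_succ_of_unoccupied {x : ℤ} (hx : ∀ l, p l ≠ x) :
    gapIndex p (x + 1) = gapIndex p x + 1 := by
  have : (Finset.univ.filter fun l' => p l' < x + 1) =
      (Finset.univ.filter fun l' => p l' < x) := by
    ext l'
    have := hx l'
    simp only [Finset.mem_filter, Finset.mem_univ, true_and]
    omega
  unfold gapIndex
  rw [this]
  ring

lemma gapIndex_mono (hp : Function.Injective p) : Monotone (gapIndex p) := by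
  refine monotone_int_of_le_succ fun x => ?_
  by_cases h : ∃ l, p l = x
  · obtain ⟨l, rfl⟩ := h
    exact (gapIndex_succ_of_occupied hp l).ge
  · push Not at h
    rw [gapIndex_succ_of_unoccupied h]
    omega

lemma gapIndex_lt_of_unoccupied (hp : Function.Injective p) {x y : ℤ} (hx : ∀ l, p l ≠ x)
    (hxy : x < y) : gapIndex p x < gapIndex p y := by
  have h := gapIndex_mono hp (Int.add_one_le_iff.2 hxy)
  rw [gapIndex_succ_of_unoccupied hx] at h
  omega

/-- Labels in the same gap fill consecutive positions, so their keys increase with the position. -/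
lemma Admissible.key_lt (h : Admissible κ p) {l l' : L} (hl : p l' < p l)
    (hg : gapIndex p (p l') = gapIndex p (p l)) : κ l' < κ l := by
  obtain ⟨n, hn⟩ : ∃ n : ℕ, p l = p l' + 1 + n := ⟨(p l - p l' - 1).toNat, by omega⟩
  induction n generalizing l with
  | zero => exact h.adj _ _ (by simpa using hn)
  | succ n ih =>
    push_cast at hn
    by_cases ho : ∃ k, p k = p l - 1
    · obtain ⟨k, hk⟩ := ho
      have h1 := gapIndex_mono h.inj (show p l' ≤ p k by omega)
      have h2 := gapIndex_mono h.inj (show p k ≤ p l by omega)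
      exact (ih (l := k) (by omega) (by omega) (by omega)).trans (h.adj _ _ (by omega))
    · -- An unoccupied position between the two labels would separate their gaps.
      push Not at ho
      have h1 := gapIndex_lt_of_unoccupied h.inj ho (show p l - 1 < p l by omega)
      have h2 := gapIndex_mono h.inj (show p l' ≤ p l - 1 by omega)
      omega

/-- In an admissible placement, positions are ordered by gap and then by key. -/
lemma Admissible.lt_iff (h : Admissible κ p) (l l' : L) :
    p l' < p l ↔ gapIndex p (p l') < gapIndex p (p l) ∨
      gapIndex p (p l') = gapIndex p (p l) ∧ κ l' < κ l := by
  have key : ∀ a b : L, p a < p b → gapIndex p (p a) < gapIndex p (p b) ∨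
      gapIndex p (p a) = gapIndex p (p b) ∧ κ a < κ b := by
    intro a b hab
    rcases (gapIndex_mono h.inj hab.le).lt_or_eq with h1 | h1
    · exact Or.inl h1
    · exact Or.inr ⟨h1, h.key_lt hab h1⟩
  refine ⟨key l' l, fun hl => ?_⟩
  rcases lt_trichotomy (p l') (p l) with h1 | h1 | h1
  · exact h1
  · obtain rfl := h.inj h1
    simp at hl
  · have := key l l' h1
    omega

lemma place_gapIndex (h : Admissible κ p) :
    place κ (fun l => gapIndex p (p l)) = p := by
  funext l
  unfold place
  rw [Finset.filter_congr fun l' _ => (h.lt_iff l l').symm]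
  unfold gapIndex
  ring

lemma place_lt_of_lex {l l' : L} (h : g l' < g l ∨ g l' = g l ∧ κ l' < κ l) :
    place κ g l' < place κ g l := by
  have hc : (Finset.univ.filter fun k => g k < g l' ∨ g k = g l' ∧ κ k < κ l').card <
      (Finset.univ.filter fun k => g k < g l ∨ g k = g l ∧ κ k < κ l).card := by
    refine Finset.card_lt_card
      (Finset.ssubset_iff_of_subset ?_ |>.2 ⟨l', by simpa using h, by simp⟩)
    intro k
    simp only [Finset.mem_filter, Finset.mem_univ, true_and]
    omega
  unfold place
  omega

lemma place_lt_iff (hκ : Function.Injective κ) (l l' : L) :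
    place κ g l' < place κ g l ↔ g l' < g l ∨ g l' = g l ∧ κ l' < κ l := by
  refine ⟨fun h => ?_, place_lt_of_lex⟩
  rcases eq_or_ne l l' with rfl | hne
  · omega
  have hk : κ l ≠ κ l' := fun h => hne (hκ h)
  by_contra hcon
  have : place κ g l < place κ g l' := place_lt_of_lex (by omega)
  omega

lemma place_injective (hκ : Function.Injective κ) : Function.Injective (place κ g) := by
  intro l l' h
  by_contra hne
  have hk : κ l ≠ κ l' := fun h => hne (hκ h)
  have h1 := place_lt_iff (g := g) hκ l l'
  have h2 := place_lt_iff (g := g) hκ l' l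
  omega

lemma gapIndex_place (hκ : Function.Injective κ) (l : L) :
    gapIndex (place κ g) (place κ g l) = g l := by
  unfold gapIndex
  rw [Finset.filter_congr fun l' _ => place_lt_iff hκ l l']
  unfold place
  ring

/-- Adjacent labels of the sorted placement lie in the same gap, since moving past an occupied
position does not change the gap. -/
lemma admissible_place (hκ : Function.Injective κ) : Admissible κ (place κ g) := by
  refine ⟨place_injective hκ, fun l l' h => ?_⟩
  rcases (place_lt_iff (g := g) hκ l' l).1 (by omega) with h1 | h1
  · have h2 := gapIndex_succ_of_occupied (place_injective (g := g) hκ) l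
    rw [← h, gapIndex_place hκ, gapIndex_place hκ] at h2
    omega
  · exact h1.2

lemma separator_strictMono : StrictMono (separator g) := by
  refine strictMono_int_of_lt_succ fun x => ?_
  have : (Finset.univ.filter fun l => g l ≤ x).card ≤
      (Finset.univ.filter fun l => g l ≤ x + 1).card := by
    refine Finset.card_le_card fun k => ?_
    simp only [Finset.mem_filter, Finset.mem_univ, true_and]
    omega
  unfold separator
  omega

lemma place_lt_separator {l : L} {β : ℤ} (h : g l ≤ β) : place κ g l < separator g β := by
  have hc : (Finset.univ.filter fun k => g k < g l ∨ g k = g l ∧ κ k < κ l).card <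
      (Finset.univ.filter fun k => g k ≤ β).card := by
    refine Finset.card_lt_card (Finset.ssubset_iff_of_subset ?_ |>.2 ⟨l, by simpa using h, by simp⟩)
    intro k
    simp only [Finset.mem_filter, Finset.mem_univ, true_and]
    omega
  unfold place separator
  omega

lemma separator_lt_place {l : L} {β : ℤ} (h : β < g l) : separator g β < place κ g l := by
  have hc : (Finset.univ.filter fun k => g k ≤ β).card ≤
      (Finset.univ.filter fun k => g k < g l ∨ g k = g l ∧ κ k < κ l).card := by
    refine Finset.card_le_card fun k => ?_
    simp only [Finset.mem_filter, Finset.mem_univ, true_and]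
    omega
  unfold place separator
  omega

lemma place_ne_separator (l : L) (β : ℤ) : place κ g l ≠ separator g β := by
  rcases le_or_gt (g l) β with h | h
  · exact (place_lt_separator h).ne
  · exact (separator_lt_place h).ne'

/-- Every unoccupied position is a separator. -/
lemma separator_gapIndex (hp : Function.Injective p) {b : ℤ} (hb : ∀ l, p l ≠ b) :
    separator (fun l => gapIndex p (p l)) (gapIndex p b) = b := by
  have : ∀ l, gapIndex p (p l) ≤ gapIndex p b ↔ p l < b := by
    intro l
    constructor
    · intro h
      by_contra hcon
      have := gapIndex_lt_of_unoccupied hp hb (show b < p l from by have := hb l; omega)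
      omega
    · exact fun h => gapIndex_mono hp h.le
  unfold separator
  rw [Finset.filter_congr fun l _ => this l]
  unfold gapIndex
  ring

lemma place_adjacent_left {l : L} {β : ℤ} (h : place κ g l + 1 = separator g β) : g l = β := by
  by_contra hne
  rcases lt_or_gt_of_ne hne with h1 | h1
  · have h2 : place κ g l < separator g (β - 1) := place_lt_separator (by omega)
    have h3 := separator_strictMono (g := g) (show β - 1 < β by omega)
    omega
  · have : separator g β < place κ g l := separator_lt_place h1
    omega

lemma place_adjacent_right {l : L} {β : ℤ} (h : place κ g l = separator g β + 1) :
    g l = β + 1 := by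
  by_contra hne
  rcases lt_or_gt_of_ne hne with h1 | h1
  · have : place κ g l < separator g β := place_lt_separator (by omega)
    omega
  · have h2 : separator g (β + 1) < place κ g l := separator_lt_place (by omega)
    have h3 := separator_strictMono (g := g) (show β < β + 1 by omega)
    omega

/-- An upper bound on the key of the label just before a separator is a bound on all keys of the
gap before it, since the gap is sorted. -/
lemma left_neighbour_iff (hκ : Function.Injective κ) (β c : ℤ) :
    (∀ l, place κ g l + 1 = separator g β → κ l < c) ↔ ∀ l, g l = β → κ l < c := by
  refine ⟨fun h l hl => ?_, fun h l hl => h l (place_adjacent_left hl)⟩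
  obtain ⟨k, hk, hmax⟩ := (Finset.univ.filter fun l => g l = β).exists_max_image κ ⟨l, by simpa⟩
  simp only [Finset.mem_filter, Finset.mem_univ, true_and] at hk hmax
  -- The label `k` with the largest key of the gap is adjacent to the separator.
  refine (hmax l hl).trans_lt (h k ?_)
  classical
  have : (Finset.univ.filter fun k => g k ≤ β) =
      insert k (Finset.univ.filter fun k' => g k' < g k ∨ g k' = g k ∧ κ k' < κ k) := by
    ext a
    simp only [Finset.mem_filter, Finset.mem_univ, true_and, Finset.mem_insert]
    constructor
    · intro ha
      rcases ha.lt_or_eq with ha | ha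
      · exact Or.inr (Or.inl (by omega))
      · rcases eq_or_ne a k with rfl | hne
        · exact Or.inl rfl
        · have h1 := hmax a ha
          have h2 : κ a ≠ κ k := fun h => hne (hκ h)
          exact Or.inr (Or.inr (by omega))
    · rintro (rfl | ha) <;> omega
  unfold place separator
  rw [this, Finset.card_insert_of_notMem (by simp)]
  push_cast
  omega

/-- A lower bound on the key of the label just after a separator is a bound on all keys of the
gap after it. -/
lemma right_neighbour_iff (β c : ℤ) :
    (∀ l, place κ g l = separator g β + 1 → c < κ l) ↔ ∀ l, g l = β + 1 → c < κ l := by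
  refine ⟨fun h l hl => ?_, fun h l hl => h l (place_adjacent_right hl)⟩
  obtain ⟨k, hk, hmin⟩ :=
    (Finset.univ.filter fun l => g l = β + 1).exists_min_image κ ⟨l, by simpa⟩
  simp only [Finset.mem_filter, Finset.mem_univ, true_and] at hk hmin
  -- The label `k` with the smallest key of the gap is adjacent to the separator.
  refine (h k ?_).trans_le (hmin l hl)
  have : (Finset.univ.filter fun k => g k ≤ β) =
      (Finset.univ.filter fun k' => g k' < g k ∨ g k' = g k ∧ κ k' < κ k) := by
    ext a
    have := hmin a
    simp only [Finset.mem_filter, Finset.mem_univ, true_and]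
    omega
  unfold place separator
  rw [this]
  omega

lemma gapIndex_of_forall_le {x : ℤ} (h : ∀ l, x ≤ p l) : gapIndex p x = x := by
  unfold gapIndex
  rw [Finset.filter_false_of_mem fun l _ => by have := h l; omega]
  simp

lemma gapIndex_of_forall_lt {x : ℤ} (h : ∀ l, p l < x) :
    gapIndex p x = x - Fintype.card L := by
  unfold gapIndex
  rw [Finset.filter_true_of_mem fun l _ => h l]
  simp

lemma separator_of_forall_lt {β : ℤ} (h : ∀ l, β < g l) : separator g β = β := by
  unfold separator
  rw [Finset.filter_false_of_mem fun l _ => by have := h l; omega]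
  simp

lemma separator_of_forall_le {β : ℤ} (h : ∀ l, g l ≤ β) :
    separator g β = β + Fintype.card L := by
  unfold separator
  rw [Finset.filter_true_of_mem fun l _ => h l]
  simp

end Line

/-! ### Signed positions and blocks -/

/-- The key of a label `a` at the signed position `v`: along a run of adjacent positions the labels
with positive sign come first and increase, those with nonpositive sign follow and decrease. -/
def signedKey (m a v : ℤ) : ℤ := if 0 < v then a else 2 * m - a

section SignedKey

variable {L : Type*} {m : ℤ} {lab : L → ℤ}

lemma signedKey_lt_iff {a v : ℤ} (ha : a < m) : signedKey m a v < m ↔ 0 < v := by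
  unfold signedKey; split_ifs <;> omega

lemma lt_signedKey_iff {a v : ℤ} (ha : a < m) : m < signedKey m a v ↔ ¬ 0 < v := by
  unfold signedKey; split_ifs <;> omega

lemma signedKey_congr {a v v' : ℤ} (h : 0 < v ↔ 0 < v') : signedKey m a v = signedKey m a v' := by
  unfold signedKey; simp only [h]

lemma signedKey_injective (hlab : Function.Injective lab) (hm : ∀ l, lab l < m) (v : L → ℤ) :
    Function.Injective fun l => signedKey m (lab l) (v l) := by
  intro l l' h
  have h1 := hm l
  have h2 := hm l'
  apply hlab
  unfold signedKey at h
  dsimp only at h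
  split_ifs at h <;> omega

end SignedKey

/-- The parameters of a block configuration: a half-line of positions, as many as `S` plus the
number of labels outside the block, on which `e = 1` records that the last position carries only the
positive sign; a block occupying the positions `b` and `b + w`; and bounds `cL`, `cR` for the keys
of the labels adjacent to the block on the left and on the right. -/
structure BlockData where
  /-- a strict upper bound for the labels -/
  M : ℤ
  /-- the number of positions left unoccupied by the labels outside the block -/
  S : ℤ
  /-- the defect of the negative half-line -/
  e : ℤ
  /-- the width of the block, minus one -/
  w : ℤ
  /-- the key bound on the left of the block -/
  cL : ℤ
  /-- the key bound on the right of the block -/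
  cR : ℤ
  e_mem : e = 0 ∨ e = 1
  w_mem : w = 0 ∨ w = 1

/-- The pairs of a position `b` of the block and signed positions `v` of the remaining labels, such
that no two labels share a position and adjacent labels have increasing keys. -/
def BlockData.configs (D : BlockData) {L : Type*} [Fintype L] (lab : L → ℤ) :
    Set (ℤ × (L → ℤ)) :=
  {x | (∀ l, -(D.S + Fintype.card L - 1 - D.e) ≤ x.2 l ∧ x.2 l ≤ D.S + Fintype.card L - 1) ∧
    Admissible (fun l => signedKey D.M (lab l) (x.2 l)) (fun l => |x.2 l|) ∧
    0 ≤ x.1 ∧ x.1 + D.w < D.S + Fintype.card L ∧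
    ∀ l, |x.2 l| ≠ x.1 ∧ |x.2 l| ≠ x.1 + D.w ∧
      (|x.2 l| + 1 = x.1 → signedKey D.M (lab l) (x.2 l) < D.cL) ∧
      (|x.2 l| = x.1 + D.w + 1 → D.cR < signedKey D.M (lab l) (x.2 l))}

/-- The signed gaps that a label `a` may choose when the block begins at the separator `β`. -/
def BlockData.slots (D : BlockData) (β a : ℤ) : Set ℤ :=
  {γ | (-(D.S - D.e) ≤ γ ∧ γ ≤ D.S) ∧ (|γ| = β → signedKey D.M a γ < D.cL) ∧
    (D.w = 1 → |γ| ≠ β + 1) ∧ (|γ| = β + D.w + 1 → D.cR < signedKey D.M a γ)}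

/-- The pairs of a separator `β` for the block and independently chosen signed gaps. -/
def BlockData.choices (D : BlockData) {L : Type*} (lab : L → ℤ) : Set (ℤ × (L → ℤ)) :=
  {y | 0 ≤ y.1 ∧ y.1 + D.w < D.S ∧ ∀ l, y.2 l ∈ D.slots y.1 (lab l)}

/-- The signed positions determined by the signed gaps `γ`. -/
def signedPlace {L : Type*} [Fintype L] (m : ℤ) (lab γ : L → ℤ) (l : L) : ℤ :=
  if 0 < γ l then place (fun l => signedKey m (lab l) (γ l)) (fun l => |γ l|) l
  else -place (fun l => signedKey m (lab l) (γ l)) (fun l => |γ l|) l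

section Signed

variable {L : Type*} [Fintype L] {m : ℤ} {lab : L → ℤ}

lemma le_place (κ g : L → ℤ) (l : L) : g l ≤ place κ g l := by
  unfold place; omega

lemma le_separator (g : L → ℤ) (β : ℤ) : β ≤ separator g β := by
  unfold separator; omega

lemma signedPlace_pos_iff (γ : L → ℤ) (l : L) : 0 < signedPlace m lab γ l ↔ 0 < γ l := by
  have := le_place (fun l => signedKey m (lab l) (γ l)) (fun l => |γ l|) l
  have := abs_nonneg (γ l)
  have := le_abs_self (γ l)
  unfold signedPlace
  split_ifs <;> omega

lemma abs_signedPlace (γ : L → ℤ) : (fun l => |signedPlace m lab γ l|) =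
    place (fun l => signedKey m (lab l) (γ l)) (fun l => |γ l|) := by
  funext l
  have h1 := le_place (fun l => signedKey m (lab l) (γ l)) (fun l => |γ l|) l
  have h2 : 0 ≤ place (fun l => signedKey m (lab l) (γ l)) (fun l => |γ l|) l :=
    (abs_nonneg (γ l)).trans h1
  unfold signedPlace
  split_ifs
  · exact abs_of_nonneg h2
  · rw [abs_neg, abs_of_nonneg h2]

lemma signedKey_signedPlace (γ : L → ℤ) :
    (fun l => signedKey m (lab l) (signedPlace m lab γ l)) =
      fun l => signedKey m (lab l) (γ l) :=
  funext fun l => signedKey_congr (signedPlace_pos_iff γ l)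

lemma eq_of_abs_eq_of_pos_iff {a b : ℤ} (h : |a| = |b|) (hs : 0 < a ↔ 0 < b) : a = b := by
  rcases abs_eq_abs.1 h with h | h <;> omega

lemma signedPlace_injective (hlab : Function.Injective lab) (hm : ∀ l, lab l < m) :
    Function.Injective (signedPlace m lab) := by
  intro γ γ' h
  have hs : ∀ l, 0 < γ l ↔ 0 < γ' l := fun l => by
    rw [← signedPlace_pos_iff (m := m) (lab := lab) γ l, h, signedPlace_pos_iff]
  have hκ : (fun l => signedKey m (lab l) (γ l)) = fun l => signedKey m (lab l) (γ' l) :=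
    funext fun l => signedKey_congr (hs l)
  have hp := abs_signedPlace (m := m) (lab := lab) γ
  rw [h, abs_signedPlace, ← hκ] at hp
  funext l
  refine eq_of_abs_eq_of_pos_iff ?_ (hs l)
  have h1 := gapIndex_place (g := fun l => |γ l|) (signedKey_injective hlab hm γ) l
  rw [← hp, gapIndex_place (signedKey_injective hlab hm γ)] at h1
  exact h1.symm

/-- Every family of signed positions that is admissible arises from signed gaps. A gap of index
`0` holds only labels with nonpositive sign, because its first label is at position `0`. -/
lemma exists_signedPlace_eq (hm : ∀ l, lab l < m) (hlab : Function.Injective lab) {v : L → ℤ}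
    (hv : Admissible (fun l => signedKey m (lab l) (v l)) fun l => |v l|) :
    ∃ γ : L → ℤ, signedPlace m lab γ = v ∧
      (∀ l, |γ l| = gapIndex (fun l => |v l|) |v l|) ∧ ∀ l, 0 < γ l ↔ 0 < v l := by
  set κ := fun l => signedKey m (lab l) (v l) with hκ
  set p := fun l => |v l| with hp
  set g := fun l => gapIndex p (p l) with hg
  have hpg : place κ g = p := place_gapIndex hv
  have hκi : Function.Injective κ := signedKey_injective hlab hm v
  have hg0 : ∀ l, 0 ≤ g l := fun l => by
    have h0 : gapIndex p 0 = 0 := gapIndex_of_forall_le fun l => abs_nonneg _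
    rw [← h0]
    exact gapIndex_mono hv.inj (abs_nonneg _)
  have hsep : separator g (-1) = -1 := separator_of_forall_lt fun l => by have := hg0 l; omega
  have hneg : ∀ l, g l = 0 → ¬ 0 < v l := fun l hl => by
    refine (lt_signedKey_iff (hm l)).1 ((right_neighbour_iff (κ := κ) (-1) m).1 ?_ l hl)
    intro k hk
    rw [hpg, hsep] at hk
    have : v k = 0 := by simpa [hp] using hk
    exact (lt_signedKey_iff (hm k)).2 (by omega)
  set γ : L → ℤ := fun l => if 0 < v l then g l else -g l with hγ
  have hsign : ∀ l, 0 < γ l ↔ 0 < v l := fun l => by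
    have h1 := hg0 l
    have h2 := hneg l
    simp only [hγ]
    split_ifs <;> omega
  have habs : ∀ l, |γ l| = g l := fun l => by
    simp only [hγ]
    split_ifs
    · exact abs_of_nonneg (hg0 l)
    · rw [abs_neg, abs_of_nonneg (hg0 l)]
  refine ⟨γ, ?_, habs, hsign⟩
  funext l
  refine eq_of_abs_eq_of_pos_iff ?_ ((signedPlace_pos_iff γ l).trans (hsign l))
  have h1 := congrFun (abs_signedPlace (m := m) (lab := lab) γ) l
  have h2 : (fun l => signedKey m (lab l) (γ l)) = κ :=
    funext fun l => signedKey_congr (hsign l)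
  have h3 : (fun l => |γ l|) = g := funext habs
  rw [h2, h3, hpg] at h1
  exact h1

lemma separator_add_one_of_empty {g : L → ℤ} {β : ℤ} (h : ∀ l, g l ≠ β + 1) :
    separator g (β + 1) = separator g β + 1 := by
  have : (Finset.univ.filter fun l => g l ≤ β + 1) = Finset.univ.filter fun l => g l ≤ β := by
    ext l
    have := h l
    simp only [Finset.mem_filter, Finset.mem_univ, true_and]
    omega
  unfold separator
  rw [this]
  ring

namespace BlockData

variable (D : BlockData)

/-- Passing from signed gaps to signed positions. -/
def toConfig (lab : L → ℤ) (y : ℤ × (L → ℤ)) : ℤ × (L → ℤ) :=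
  (separator (fun l => |y.2 l|) y.1, signedPlace D.M lab y.2)

variable {D}

/-- A block of width two occupies two consecutive separators, since the gap between them is
empty. -/
lemma separator_add_width {y : ℤ × (L → ℤ)} (hy : y ∈ D.choices lab) :
    separator (fun l => |y.2 l|) (y.1 + D.w) = separator (fun l => |y.2 l|) y.1 + D.w := by
  rcases D.w_mem with hw | hw
  · simp [hw]
  · rw [hw]
    exact separator_add_one_of_empty fun l => (hy.2.2 l).2.2.1 hw

lemma abs_le_of_mem_choices {L : Type*} {lab : L → ℤ} {y : ℤ × (L → ℤ)}
    (hy : y ∈ D.choices lab) (l : L) : |y.2 l| ≤ D.S := by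
  have h := (hy.2.2 l).1
  have := D.e_mem
  exact abs_le.2 ⟨by omega, h.2⟩

lemma mapsTo_toConfig (hlab : Function.Injective lab) (hm : ∀ l, lab l < D.M) :
    Set.MapsTo (D.toConfig lab) (D.choices lab) (D.configs lab) := by
  rintro ⟨β, γ⟩ hy
  have hw := separator_add_width hy
  have hS := abs_le_of_mem_choices hy
  obtain ⟨hβ, hβS, hγ⟩ := hy
  have hκ := signedKey_injective hlab hm γ
  have habs := fun l => congrFun (abs_signedPlace (m := D.M) (lab := lab) γ) l
  have hkey := fun l => congrFun (signedKey_signedPlace (m := D.M) (lab := lab) γ) l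
  have hsign := fun l => signedPlace_pos_iff (m := D.M) (lab := lab) γ l
  have hsepS : separator (fun l => |γ l|) D.S = D.S + Fintype.card L :=
    separator_of_forall_le hS
  dsimp only at hβ hβS hw habs hkey hγ
  simp only [toConfig, configs, Set.mem_ofPred_eq, hkey, habs]
  set κ := fun l => signedKey D.M (lab l) (γ l)
  set g := fun l => |γ l|
  have hlt : ∀ l, place κ g l < D.S + Fintype.card L := fun l =>
    hsepS ▸ place_lt_separator (hS l)
  refine ⟨fun l => ?_, ?_, hβ.trans (le_separator _ _), ?_,
    fun l => ⟨place_ne_separator _ _, ?_, ?_, ?_⟩⟩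
  · have h1 := hlt l
    have h2 := habs l
    have h3 := abs_le.1 h2.le
    -- For `e = 1` the last gap holds only positive labels, hence so does the last position.
    have hlast : D.e = 1 → place κ g l + 1 = separator g D.S → κ l < D.M := fun he =>
      (left_neighbour_iff hκ D.S D.M).2 (fun k hk => (signedKey_lt_iff (hm k)).2 (by
        have := (hγ k).1
        rcases abs_cases (γ k) with h | h <;> simp only [g] at hk <;> omega)) l
    rw [hsepS] at hlast
    refine ⟨?_, by omega⟩
    rcases D.e_mem with he | he
    · omega
    · by_contra hcon
      have h4 := (signedKey_lt_iff (hm l)).1 (hlast he (by omega))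
      have := (hsign l).2 h4
      have := hS l
      have := abs_nonneg (γ l)
      omega
  · exact admissible_place hκ
  · rw [← hw, ← hsepS]
    exact separator_strictMono hβS
  · rw [← hw]
    exact place_ne_separator _ _
  · exact (left_neighbour_iff hκ β D.cL).2 (fun k hk => (hγ k).2.1 hk) l
  · rw [← hw]
    exact (right_neighbour_iff (β + D.w) D.cR).2 (fun k hk => (hγ k).2.2.2 hk) l

lemma injOn_toConfig (hlab : Function.Injective lab) (hm : ∀ l, lab l < D.M) :
    Set.InjOn (D.toConfig lab) (D.choices lab) := by
  rintro ⟨β, γ⟩ - ⟨β', γ'⟩ - h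
  simp only [toConfig, Prod.mk.injEq] at h
  obtain rfl := signedPlace_injective hlab hm h.2
  rw [separator_strictMono.injective h.1]

lemma surjOn_toConfig (hlab : Function.Injective lab) (hm : ∀ l, lab l < D.M) :
    Set.SurjOn (D.toConfig lab) (D.choices lab) (D.configs lab) := by
  rintro ⟨b, v⟩ ⟨hr, hadm, hb, hbw, hn⟩
  dsimp only at hr hadm hb hbw hn
  obtain ⟨γ, rfl, hg, hs⟩ := exists_signedPlace_eq hm hlab hadm
  have hκ := signedKey_injective hlab hm γ
  have habs := fun l => congrFun (abs_signedPlace (m := D.M) (lab := lab) γ) l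
  have hkey := fun l => congrFun (signedKey_signedPlace (m := D.M) (lab := lab) γ) l
  simp only [hkey, habs] at hn hadm
  simp only [habs] at hg
  set κ := fun l => signedKey D.M (lab l) (γ l)
  set g := fun l => |γ l|
  set p := place κ g
  have hpK : ∀ l, p l < D.S + Fintype.card L := fun l => by
    have h1 := hr l
    have h2 := D.e_mem
    have h3 : |signedPlace D.M lab γ l| ≤ D.S + Fintype.card L - 1 :=
      abs_le.2 ⟨by omega, h1.2⟩
    rw [habs] at h3
    omega
  have hp0 : ∀ l, 0 ≤ p l := fun l => (abs_nonneg (γ l)).trans (le_place κ g l)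
  have hK : gapIndex p (D.S + Fintype.card L) = D.S := by
    rw [gapIndex_of_forall_lt hpK]; ring
  have hS : ∀ l, g l ≤ D.S := fun l => by
    have := gapIndex_mono hadm.inj (hpK l).le
    rw [hK] at this
    exact (hg l).trans_le this
  have hsepS : separator g D.S = D.S + Fintype.card L := separator_of_forall_le hS
  have hgf : (fun l => gapIndex p (p l)) = g := funext fun l => (hg l).symm
  have hsep : ∀ x, (∀ l, p l ≠ x) → separator g (gapIndex p x) = x := fun x hx => by
    rw [← hgf]; exact separator_gapIndex hadm.inj hx
  have hsb := hsep b fun l => (hn l).1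
  have hsbw := hsep (b + D.w) fun l => (hn l).2.1
  have hgw : gapIndex p (b + D.w) = gapIndex p b + D.w := by
    rcases D.w_mem with hw | hw
    · simp [hw]
    · rw [hw]
      exact gapIndex_succ_of_unoccupied fun l => (hn l).1
  have hlastw : gapIndex p (b + D.w) < D.S := by
    rw [← hK]
    exact gapIndex_lt_of_unoccupied hadm.inj (fun l => (hn l).2.1) hbw
  refine ⟨(gapIndex p b, γ), ?_, Prod.ext hsb rfl⟩
  simp only [choices, slots, Set.mem_ofPred_eq]
  refine ⟨?_, ?_, fun l => ⟨⟨?_, ?_⟩, ?_, fun hw1 hl => ?_, ?_⟩⟩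
  · have h0 : gapIndex p 0 = 0 := gapIndex_of_forall_le hp0
    rw [← h0]
    exact gapIndex_mono hadm.inj hb
  · exact hgw ▸ hlastw
  · have h1 := (abs_le.1 (hS l)).1
    rcases D.e_mem with he | he
    · omega
    · by_contra hcon
      have hgl : g l = D.S := by
        have := neg_abs_le (γ l)
        have := hS l
        simp only [g] at *
        omega
      refine absurd ((signedKey_lt_iff (hm l)).1
        ((left_neighbour_iff hκ D.S D.M).1 (fun k hk => ?_) l hgl)) ?_
      · refine (signedKey_lt_iff (hm k)).2 ?_
        rw [hs]
        have h2 := habs k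
        have h3 := hr k
        rw [hsepS] at hk
        change p k + 1 = _ at hk
        have h4 : |signedPlace D.M lab γ k| = D.S + Fintype.card L - 1 := by rw [h2]; omega
        rcases abs_cases (signedPlace D.M lab γ k) with h5 | h5 <;> omega
      · have := (abs_nonneg (γ l)).trans (hS l)
        omega
  · exact (le_abs_self _).trans (hS l)
  · refine (left_neighbour_iff (g := g) hκ _ D.cL).1 (fun k hk => (hn k).2.2.1 ?_) l
    rw [hsb] at hk
    exact hk
  · rw [hw1] at hgw hsbw
    have h1 : p l < separator g (gapIndex p b + 1) := place_lt_separator hl.le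
    have h2 : separator g (gapIndex p b) < p l :=
      separator_lt_place (show gapIndex p b < |γ l| by omega)
    rw [← hgw, hsbw] at h1
    rw [hsb] at h2
    omega
  · rw [← hgw]
    refine (right_neighbour_iff (κ := κ) (g := g) _ D.cR).1 (fun k hk => (hn k).2.2.2 ?_) l
    rw [hsbw] at hk
    exact hk

/-- The block begins at position `0` exactly if it begins at the separator `0` and no label lies in
the gap before it. -/
lemma toConfig_fst_eq_zero_iff {y : ℤ × (L → ℤ)} (hy : y ∈ D.choices lab) :
    (D.toConfig lab y).1 = 0 ↔ y.1 = 0 ∧ ∀ l, y.2 l ≠ 0 := by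
  have h0 := hy.1
  unfold toConfig separator
  constructor
  · intro h
    dsimp only at h
    refine ⟨by omega, fun l hl => ?_⟩
    have h1 : (Finset.univ.filter fun l => |y.2 l| ≤ y.1).card = 0 := by omega
    rw [Finset.card_eq_zero, Finset.filter_eq_empty_iff] at h1
    exact h1 (Finset.mem_univ l) (by simpa [hl] using h0)
  · rintro ⟨h1, h2⟩
    dsimp only
    rw [h1, Finset.filter_false_of_mem fun l _ => by simpa using h2 l]
    simp

/-- The block ends at the last position exactly if it ends at the last separator and no label lies
in the gap after it. -/
lemma toConfig_fst_eq_last_iff {y : ℤ × (L → ℤ)} (hy : y ∈ D.choices lab) :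
    (D.toConfig lab y).1 + D.w = D.S + Fintype.card L - 1 ↔
      y.1 + D.w = D.S - 1 ∧ ∀ l, |y.2 l| ≠ D.S := by
  have h0 := hy.2.1
  have hS := abs_le_of_mem_choices hy
  have hw := separator_add_width hy
  simp only [toConfig]
  rw [← hw]
  constructor
  · intro h
    have hc : (Finset.univ.filter fun l => |y.2 l| ≤ y.1 + D.w).card ≤ Fintype.card L :=
      Finset.card_le_univ _
    unfold separator at h
    dsimp only at h
    refine ⟨by omega, fun l hl => ?_⟩
    have h1 : (Finset.univ.filter fun l => |y.2 l| ≤ y.1 + D.w).card = Fintype.card L := by omega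
    rw [Finset.card_eq_iff_eq_univ, Finset.filter_eq_self] at h1
    have := h1 l (Finset.mem_univ l)
    omega
  · rintro ⟨h1, h2⟩
    rw [h1, separator_of_forall_le fun l => by have := h2 l; have := hS l; omega]
    ring

end BlockData

end Signed

/-! ### Counting block configurations -/

lemma ncard_sigma_pi {L : Type*} [Fintype L] (I : Finset ℤ) (A : ℤ → L → Set ℤ)
    (hA : ∀ β l, (A β l).Finite) :
    {y : ℤ × (L → ℤ) | y.1 ∈ I ∧ ∀ l, y.2 l ∈ A y.1 l}.ncard =
      ∑ β ∈ I, ∏ l, (A β l).ncard := by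
  classical
  have : {y : ℤ × (L → ℤ) | y.1 ∈ I ∧ ∀ l, y.2 l ∈ A y.1 l} =
      (fun z : Σ _ : ℤ, L → ℤ => (z.1, z.2)) ''
        (I.sigma fun β => Fintype.piFinset fun l => (hA β l).toFinset) := by
    ext ⟨β, γ⟩
    simp only [Set.mem_ofPred_eq, Set.mem_image, Finset.mem_coe, Finset.mem_sigma,
      Fintype.mem_piFinset, Set.Finite.mem_toFinset]
    constructor
    · exact fun h => ⟨⟨β, γ⟩, h, rfl⟩
    · rintro ⟨⟨β', γ'⟩, h, hh⟩
      cases hh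
      exact h
  rw [this, Set.ncard_image_of_injective, Set.ncard_coe_finset, Finset.card_sigma]
  · refine Finset.sum_congr rfl fun β _ => ?_
    rw [Fintype.card_piFinset]
    exact Finset.prod_congr rfl fun l _ => (Set.ncard_eq_toFinset_card _ (hA β l)).symm
  · rintro ⟨β, γ⟩ ⟨β', γ'⟩ h
    cases h
    rfl

namespace BlockData

/-- The number of signed gaps available to the label `a` when the block begins at the separator
`β`: all of them, minus the forbidden ones in the gaps next to and inside the block. The gap `0`
has no positive half, and for `e = 1` the gap `S` has no negative half. -/
def slotCount (D : BlockData) (β a : ℤ) : ℤ :=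
  2 * D.S + 1 - D.e - (if 0 < β ∧ D.cL ≤ a then 1 else 0) - (if D.cL ≤ 2 * D.M - a then 1 else 0)
    - 2 * D.w - (if a ≤ D.cR then 1 else 0)
    - (if (D.e = 0 ∨ β + D.w + 1 < D.S) ∧ 2 * D.M - a ≤ D.cR then 1 else 0)

lemma finite_slots (D : BlockData) (β a : ℤ) : (D.slots β a).Finite :=
  (Set.finite_Icc (-(D.S - D.e)) D.S).subset fun _ h => h.1

/-- The indicator function of the available signed gaps, as one minus the indicator functions of the
forbidden ones. -/
lemma ite_mem_slots (D : BlockData) {β : ℤ} (a : ℤ) (h0 : 0 ≤ β) (hS : β + D.w < D.S) {γ : ℤ}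
    (hγ : γ ∈ Finset.Icc (-(D.S - D.e)) D.S) [Decidable (γ ∈ D.slots β a)] :
    (if γ ∈ D.slots β a then 1 else 0 : ℤ) =
      1 - (if γ = β then (if 0 < β ∧ D.cL ≤ a then 1 else 0) else 0)
        - (if γ = -β then (if D.cL ≤ 2 * D.M - a then 1 else 0) else 0)
        - (if γ = β + 1 then D.w else 0) - (if γ = -(β + 1) then D.w else 0)
        - (if γ = β + D.w + 1 then (if a ≤ D.cR then 1 else 0) else 0)
        - (if γ = -(β + D.w + 1) then
          (if (D.e = 0 ∨ β + D.w + 1 < D.S) ∧ 2 * D.M - a ≤ D.cR then 1 else 0) else 0) := by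
  rw [Finset.mem_Icc] at hγ
  have he := D.e_mem
  simp only [slots, signedKey, Set.mem_ofPred_eq]
  rcases D.w_mem with hw | hw <;>
    simp only [hw, zero_ne_one, false_imp_iff, true_and, forall_const, add_zero] at hS ⊢ <;>
    by_cases hp : 0 < γ
  · simp only [hp, if_true, abs_of_pos hp, show γ ≠ -β by omega, show γ ≠ -(β + 1) by omega,
      if_false]
    split_ifs <;> omega
  · simp only [hp, abs_of_nonpos (not_lt.1 hp), show γ ≠ β + 1 by omega, if_false]
    split_ifs <;> omega
  · simp only [hp, if_true, abs_of_pos hp, show γ ≠ -β by omega, show γ ≠ -(β + 1) by omega,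
      show γ ≠ -(β + 1 + 1) by omega, if_false]
    split_ifs <;> omega
  · simp only [hp, abs_of_nonpos (not_lt.1 hp), show γ ≠ β + 1 by omega,
      show γ ≠ β + 1 + 1 by omega, if_false]
    split_ifs <;> omega

lemma ncard_slots (D : BlockData) {β : ℤ} (a : ℤ) (h0 : 0 ≤ β) (hS : β + D.w < D.S) :
    ((D.slots β a).ncard : ℤ) = D.slotCount β a := by
  classical
  have h1 : D.slots β a =
      ((Finset.Icc (-(D.S - D.e)) D.S).filter (· ∈ D.slots β a) : Finset ℤ) := by
    ext γ
    simp only [Finset.coe_filter, Finset.mem_Icc, Set.mem_ofPred_eq, iff_and_self]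
    exact fun h => h.1
  rw [h1, Set.ncard_coe_finset, Finset.card_filter]
  push_cast
  rw [Finset.sum_congr rfl fun γ hγ => ite_mem_slots D a h0 hS hγ]
  have he := D.e_mem
  have hw := D.w_mem
  have hcard : ((2 * D.S + 1 - D.e).toNat : ℤ) = 2 * D.S + 1 - D.e := by omega
  have hIcc : D.S + 1 - -(D.S - D.e) = 2 * D.S + 1 - D.e := by ring
  simp only [Finset.sum_sub_distrib, Finset.sum_ite_eq', Finset.sum_const, Int.card_Icc,
    Finset.mem_Icc]
  have hw1 : (if -(D.S - D.e) ≤ β + 1 ∧ β + 1 ≤ D.S then D.w else 0) = D.w :=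
    if_pos (by omega)
  have hw2 : (if -(D.S - D.e) ≤ -(β + 1) ∧ -(β + 1) ≤ D.S then D.w else 0) = D.w := by
    split_ifs <;> omega
  have hlast : (if -(D.S - D.e) ≤ -(β + D.w + 1) ∧ -(β + D.w + 1) ≤ D.S then
      (if (D.e = 0 ∨ β + D.w + 1 < D.S) ∧ 2 * D.M - a ≤ D.cR then 1 else 0) else 0 : ℤ) =
      if (D.e = 0 ∨ β + D.w + 1 < D.S) ∧ 2 * D.M - a ≤ D.cR then 1 else 0 := by
    split_ifs <;> omega
  rw [hIcc, nsmul_one, hcard, hw1, hw2, hlast,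
    if_pos (show -(D.S - D.e) ≤ β ∧ β ≤ D.S by omega),
    if_pos (show -(D.S - D.e) ≤ -β ∧ -β ≤ D.S by omega),
    if_pos (show -(D.S - D.e) ≤ β + D.w + 1 ∧ β + D.w + 1 ≤ D.S by omega)]
  unfold slotCount
  ring

/-- The variant of `D` in which no label may be adjacent to the block on its left. -/
def noLeft (D : BlockData) : BlockData := { D with cL := 0 }

/-- The variant of `D` in which no label may be adjacent to the block on its right. -/
def noRight (D : BlockData) : BlockData := { D with cR := 2 * D.M }

/-- The configurations in which the block does not begin at the first position if `f₀` holds, and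
does not end at the last position if `f₁` holds. -/
def restrictedConfigs (D : BlockData) {L : Type*} [Fintype L] (lab : L → ℤ) (f₀ f₁ : Prop) :
    Set (ℤ × (L → ℤ)) :=
  {x ∈ D.configs lab | (f₀ → x.1 ≠ 0) ∧ (f₁ → x.1 + D.w ≠ D.S + Fintype.card L - 1)}

section Count

variable {L : Type*} [Fintype L] {lab : L → ℤ} (D : BlockData)

lemma choices_eq {L : Type*} {lab : L → ℤ} : D.choices lab =
    {y | y.1 ∈ Finset.Ico 0 (D.S - D.w) ∧ ∀ l, y.2 l ∈ D.slots y.1 (lab l)} := by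
  ext y
  simp only [choices, Set.mem_ofPred_eq, Finset.mem_Ico, lt_sub_iff_add_lt, and_assoc]

lemma ncard_choices_of_mem (I : Finset ℤ) (hI : ∀ β ∈ I, 0 ≤ β ∧ β + D.w < D.S) :
    ({y : ℤ × (L → ℤ) | y.1 ∈ I ∧ ∀ l, y.2 l ∈ D.slots y.1 (lab l)}.ncard : ℤ) =
      ∑ β ∈ I, ∏ l, D.slotCount β (lab l) := by
  rw [ncard_sigma_pi I (fun β l => D.slots β (lab l)) fun β l => D.finite_slots _ _]
  push_cast
  exact Finset.sum_congr rfl fun β hβ => Finset.prod_congr rfl fun l _ =>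
    D.ncard_slots _ (hI β hβ).1 (hI β hβ).2

lemma finite_choices : (D.choices lab).Finite := by
  refine ((Set.finite_Icc 0 D.S).prod
    (Set.Finite.pi' fun _ : L => Set.finite_Icc (-(D.S - D.e)) D.S)).subset ?_
  rintro y ⟨h0, h1, h2⟩
  have := D.w_mem
  exact ⟨⟨h0, by omega⟩, fun l => (h2 l).1⟩

/-- The number of configurations is a sum over the separators at which the block may begin. The
configurations whose block begins at the first position, or ends at the last one, are removed. -/
theorem ncard_restrictedConfigs (hlab : Function.Injective lab) (hm : ∀ l, lab l < D.M)
    (hlab0 : ∀ l, 0 ≤ lab l) (hS : D.w + 1 < D.S) (f₀ f₁ : Prop) [Decidable f₀] [Decidable f₁] :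
    ((D.restrictedConfigs lab f₀ f₁).ncard : ℤ) =
      ∑ β ∈ Finset.Ico 0 (D.S - D.w), ∏ l, D.slotCount β (lab l)
        - (if f₀ then ∏ l, D.noLeft.slotCount 0 (lab l) else 0)
        - (if f₁ then ∏ l, D.noRight.slotCount (D.S - 1 - D.w) (lab l) else 0) := by
  have hw := D.w_mem
  -- Excluding labels next to the block on its left turns the choices at the separator `0` into
  -- those whose block begins at the first position, and likewise for the last separator and
  -- position.
  set B₀ : Set (ℤ × (L → ℤ)) := {y | y.1 ∈ ({0} : Finset ℤ) ∧
    ∀ l, y.2 l ∈ D.noLeft.slots y.1 (lab l)} with hB₀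
  set B₁ : Set (ℤ × (L → ℤ)) := {y | y.1 ∈ ({D.S - 1 - D.w} : Finset ℤ) ∧
    ∀ l, y.2 l ∈ D.noRight.slots y.1 (lab l)} with hB₁
  have key : ∀ a v, 0 ≤ a → a < D.M → 0 ≤ signedKey D.M a v ∧ signedKey D.M a v ≤ 2 * D.M := by
    intro a v h1 h2
    unfold signedKey
    split_ifs <;> omega
  have mem₀ : ∀ y, y ∈ B₀ ↔ y ∈ D.choices lab ∧ y.1 = 0 ∧ ∀ l, y.2 l ≠ 0 := by
    rintro ⟨β, γ⟩
    simp only [hB₀, choices, slots, noLeft, Set.mem_ofPred_eq, Finset.mem_singleton]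
    constructor
    · rintro ⟨rfl, h⟩
      have hne : ∀ l, γ l ≠ 0 := fun l hl => by
        have h1 := (h l).2.1 (by simp [hl])
        have h2 := key _ (γ l) (hlab0 l) (hm l)
        omega
      exact ⟨⟨le_rfl, by omega, fun l => ⟨(h l).1, fun h0 => absurd (abs_eq_zero.1 h0) (hne l),
        (h l).2.2⟩⟩, rfl, hne⟩
    · rintro ⟨⟨-, -, h⟩, rfl, hne⟩
      exact ⟨rfl, fun l => ⟨(h l).1, fun h0 => absurd (abs_eq_zero.1 h0) (hne l), (h l).2.2⟩⟩
  have mem₁ : ∀ y, y ∈ B₁ ↔ y ∈ D.choices lab ∧ y.1 + D.w = D.S - 1 ∧ ∀ l, |y.2 l| ≠ D.S := by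
    rintro ⟨β, γ⟩
    simp only [hB₁, choices, slots, noRight, Set.mem_ofPred_eq, Finset.mem_singleton]
    constructor
    · rintro ⟨rfl, h⟩
      have hne : ∀ l, |γ l| ≠ D.S := fun l hl => by
        have h1 := (h l).2.2.2 (by omega)
        have h2 := key _ (γ l) (hlab0 l) (hm l)
        omega
      exact ⟨⟨by omega, by omega, fun l => ⟨(h l).1, (h l).2.1, (h l).2.2.1,
        fun h0 => absurd (by omega) (hne l)⟩⟩, by omega, hne⟩
    · rintro ⟨⟨-, -, h⟩, h1, hne⟩
      exact ⟨by omega, fun l => ⟨(h l).1, (h l).2.1, (h l).2.2.1,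
        fun h0 => absurd (by omega) (hne l)⟩⟩
  have himage : D.restrictedConfigs lab f₀ f₁ = D.toConfig lab ''
      ((D.choices lab \ {y | f₀ ∧ y ∈ B₀}) \ {y | f₁ ∧ y ∈ B₁}) := by
    ext x
    simp only [restrictedConfigs, Set.mem_ofPred_eq, Set.mem_image, Set.mem_sdiff, mem₀, mem₁]
    constructor
    · rintro ⟨hx, h0, h1⟩
      obtain ⟨y, hy, rfl⟩ := surjOn_toConfig hlab hm hx
      rw [Ne, toConfig_fst_eq_zero_iff hy] at h0
      rw [Ne, toConfig_fst_eq_last_iff hy] at h1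
      exact ⟨y, ⟨⟨hy, fun h => h0 h.1 h.2.2⟩, fun h => h1 h.1 h.2.2⟩, rfl⟩
    · rintro ⟨y, ⟨⟨hy, h0⟩, h1⟩, rfl⟩
      refine ⟨mapsTo_toConfig hlab hm hy, ?_, ?_⟩
      · rw [Ne, toConfig_fst_eq_zero_iff hy]
        exact fun hf h => h0 ⟨hf, hy, h⟩
      · rw [Ne, toConfig_fst_eq_last_iff hy]
        exact fun hf h => h1 ⟨hf, hy, h⟩
  have hsub₀ : {y | f₀ ∧ y ∈ B₀} ⊆ D.choices lab := fun y h => ((mem₀ y).1 h.2).1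
  have hsub₁ : {y | f₁ ∧ y ∈ B₁} ⊆ D.choices lab \ {y | f₀ ∧ y ∈ B₀} := fun y h => by
    have h1 := (mem₁ y).1 h.2
    refine ⟨h1.1, fun h2 => ?_⟩
    have h3 := (mem₀ y).1 h2.2
    omega
  have hfin := D.finite_choices (lab := lab)
  have hc := D.ncard_choices_of_mem (lab := lab) (Finset.Ico 0 (D.S - D.w)) fun β hβ => by
    rw [Finset.mem_Ico] at hβ; omega
  rw [← choices_eq] at hc
  have hc₀ := D.noLeft.ncard_choices_of_mem (lab := lab) {0} fun β hβ => by
    rw [Finset.mem_singleton] at hβ; subst hβ; exact ⟨le_rfl, by show 0 + D.w < D.S; omega⟩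
  have hc₁ := D.noRight.ncard_choices_of_mem (lab := lab) {D.S - 1 - D.w} fun β hβ => by
    rw [Finset.mem_singleton] at hβ
    exact ⟨by omega, by show β + D.w < D.S; omega⟩
  rw [Finset.sum_singleton, ← hB₀] at hc₀
  rw [Finset.sum_singleton, ← hB₁] at hc₁
  rw [himage, ((injOn_toConfig hlab hm).mono
    (Set.sdiff_subset.trans Set.sdiff_subset)).ncard_image]
  have e1 := Set.ncard_sdiff_add_ncard_of_subset hsub₁ (hfin.subset Set.sdiff_subset)
  have e0 := Set.ncard_sdiff_add_ncard_of_subset hsub₀ hfin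
  have i0 : ({y | f₀ ∧ y ∈ B₀}.ncard : ℤ) =
      if f₀ then ∏ l, D.noLeft.slotCount 0 (lab l) else 0 := by
    split_ifs with h <;> simp [h, hc₀]
  have i1 : ({y | f₁ ∧ y ∈ B₁}.ncard : ℤ) =
      if f₁ then ∏ l, D.noRight.slotCount (D.S - 1 - D.w) (lab l) else 0 := by
    split_ifs with h <;> simp [h, hc₁]
  rw [← hc, ← i0, ← i1]
  omega

end Count

end BlockData

/-! ### Points of the restricted arrangement -/

section Membership

variable {m : ℕ} {q : ℕ}

lemma mem_diffHyperplane_mod (s t : Fin m) (c : ℤ) (x : Fin m → ZMod q) :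
    x ∈ (diffHyperplane s t c).mod q ↔ x s - x t = (c : ZMod q) := by
  simp [IntHyperplane.mod, diffHyperplane, Pi.single_apply, sub_mul, Finset.sum_sub_distrib]

lemma mem_sumHyperplane_mod (s t : Fin m) (c : ℤ) (x : Fin m → ZMod q) :
    x ∈ (sumHyperplane s t c).mod q ↔ x s + x t = (c : ZMod q) := by
  simp [IntHyperplane.mod, sumHyperplane, Pi.single_apply, add_mul, Finset.sum_add_distrib]

lemma diffHyperplane_injective {a b s t : Fin m} {c d : ℤ} (hab : a < b) (hst : s < t) :
    diffHyperplane a b c = diffHyperplane s t d ↔ a = s ∧ b = t ∧ c = d := by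
  refine ⟨fun h => ?_, by rintro ⟨rfl, rfl, rfl⟩; rfl⟩
  simp only [diffHyperplane, IntHyperplane.mk.injEq] at h
  obtain ⟨h1, rfl⟩ := h
  have ha := congrFun h1 a
  have hb := congrFun h1 b
  simp only [Pi.sub_apply, Pi.single_apply] at ha hb
  split_ifs at ha hb <;> omega

lemma sumHyperplane_injective {a b s t : Fin m} {c d : ℤ} (hab : a < b) (hst : s < t) :
    sumHyperplane a b c = sumHyperplane s t d ↔ a = s ∧ b = t ∧ c = d := by
  refine ⟨fun h => ?_, by rintro ⟨rfl, rfl, rfl⟩; rfl⟩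
  simp only [sumHyperplane, IntHyperplane.mk.injEq] at h
  obtain ⟨h1, rfl⟩ := h
  have ha := congrFun h1 a
  have hb := congrFun h1 b
  simp only [Pi.add_apply, Pi.single_apply] at ha hb
  split_ifs at ha hb <;> omega

lemma diffHyperplane_ne_sumHyperplane {a b s t : Fin m} {c d : ℤ} (hab : a < b) :
    diffHyperplane a b c ≠ sumHyperplane s t d := by
  intro h
  have hb := congrFun (congrArg IntHyperplane.coeff h) b
  simp only [diffHyperplane, sumHyperplane, Pi.sub_apply, Pi.add_apply, Pi.single_apply] at hb
  split_ifs at hb <;> omega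

lemma mem_restrictionComplement {A : Set (IntHyperplane m)} {H : IntHyperplane m}
    {x : Fin m → ZMod q} :
    x ∈ restrictionComplement A H q ↔ x ∈ H.mod q ∧ ∀ K ∈ A, K ≠ H → x ∉ K.mod q := by
  simp only [restrictionComplement, restrictionMod, Set.mem_sdiff, Set.mem_sUnion,
    Set.mem_ofPred_eq, not_exists, not_and]
  refine and_congr_right fun hx => ⟨fun h K hK hne hxK => ?_, ?_⟩
  · exact h _ ⟨K, hK, hne, rfl⟩ ⟨hx, hxK⟩
  · rintro h _ ⟨K, hK, hne, rfl⟩ hxK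
    exact h K hK hne hxK.2

/-- Two coordinates that avoid all four hyperplanes of type D on them. -/
def AvoidsShi (x y : ZMod q) : Prop :=
  x - y ≠ 0 ∧ x - y ≠ 1 ∧ x + y ≠ 0 ∧ x + y ≠ 1

lemma mem_restrictionComplement_diff {s t : Fin m} (hst : s < t) {c : ℤ} (hc : c = 0 ∨ c = 1)
    {x : Fin m → ZMod q} :
    x ∈ restrictionComplement (shiD m) (diffHyperplane s t c) q ↔
      (x s - x t = (c : ZMod q) ∧ x s - x t ≠ ((1 - c : ℤ) : ZMod q) ∧
        x s + x t ≠ 0 ∧ x s + x t ≠ 1) ∧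
      ∀ a b, a < b → ¬(a = s ∧ b = t) → AvoidsShi (x a) (x b) := by
  rw [mem_restrictionComplement, mem_diffHyperplane_mod]
  constructor
  · rintro ⟨h0, h⟩
    have hd : ∀ a b : Fin m, a < b → ∀ d : ℤ, d = 0 ∨ d = 1 → ¬(a = s ∧ b = t ∧ d = c) →
        x a - x b ≠ (d : ZMod q) := fun a b hab d hd hne => by
      rw [← diffHyperplane_injective hab hst] at hne
      rw [Ne, ← mem_diffHyperplane_mod]
      exact h _ ⟨a, b, hab, d, hd, Or.inl rfl⟩ hne
    have hs : ∀ a b : Fin m, a < b → ∀ d : ℤ, d = 0 ∨ d = 1 → x a + x b ≠ (d : ZMod q) :=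
      fun a b hab d hd => by
      rw [Ne, ← mem_sumHyperplane_mod]
      exact h _ ⟨a, b, hab, d, hd, Or.inr rfl⟩ (diffHyperplane_ne_sumHyperplane hst).symm
    have hs0 := fun a b hab => hs a b hab 0 (Or.inl rfl)
    have hs1 := fun a b hab => hs a b hab 1 (Or.inr rfl)
    simp only [Int.cast_zero, Int.cast_one] at hs0 hs1
    refine ⟨⟨h0, hd s t hst (1 - c) (by omega) (by omega), hs0 s t hst, hs1 s t hst⟩,
      fun a b hab hne => ?_⟩
    have h1 := hd a b hab 0 (Or.inl rfl) (by tauto)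
    have h2 := hd a b hab 1 (Or.inr rfl) (by tauto)
    simp only [Int.cast_zero, Int.cast_one] at h1 h2
    exact ⟨h1, h2, hs0 a b hab, hs1 a b hab⟩
  · rintro ⟨⟨h0, h1, h2, h3⟩, h⟩
    refine ⟨h0, ?_⟩
    rintro K ⟨a, b, hab, d, hd, rfl | rfl⟩ hne
    · rw [mem_diffHyperplane_mod]
      rw [Ne, diffHyperplane_injective hab hst] at hne
      by_cases hh : a = s ∧ b = t
      · obtain ⟨rfl, rfl⟩ := hh
        obtain rfl : d = 1 - c := by omega
        exact h1
      · have := h a b hab hh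
        rcases hd with rfl | rfl
        · simpa using this.1
        · simpa using this.2.1
    · rw [mem_sumHyperplane_mod]
      by_cases hh : a = s ∧ b = t
      · obtain ⟨rfl, rfl⟩ := hh
        rcases hd with rfl | rfl
        · simpa using h2
        · simpa using h3
      · have := h a b hab hh
        rcases hd with rfl | rfl
        · simpa using this.2.2.1
        · simpa using this.2.2.2

lemma mem_restrictionComplement_sum {s t : Fin m} (hst : s < t) {c : ℤ} (hc : c = 0 ∨ c = 1)
    {x : Fin m → ZMod q} :
    x ∈ restrictionComplement (shiD m) (sumHyperplane s t c) q ↔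
      (x s + x t = (c : ZMod q) ∧ x s + x t ≠ ((1 - c : ℤ) : ZMod q) ∧
        x s - x t ≠ 0 ∧ x s - x t ≠ 1) ∧
      ∀ a b, a < b → ¬(a = s ∧ b = t) → AvoidsShi (x a) (x b) := by
  rw [mem_restrictionComplement, mem_sumHyperplane_mod]
  constructor
  · rintro ⟨h0, h⟩
    have hd : ∀ a b : Fin m, a < b → ∀ d : ℤ, d = 0 ∨ d = 1 → ¬(a = s ∧ b = t ∧ d = c) →
        x a + x b ≠ (d : ZMod q) := fun a b hab d hd hne => by
      rw [← sumHyperplane_injective hab hst] at hne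
      rw [Ne, ← mem_sumHyperplane_mod]
      exact h _ ⟨a, b, hab, d, hd, Or.inr rfl⟩ hne
    have hs : ∀ a b : Fin m, a < b → ∀ d : ℤ, d = 0 ∨ d = 1 → x a - x b ≠ (d : ZMod q) :=
      fun a b hab d hd => by
      rw [Ne, ← mem_diffHyperplane_mod]
      exact h _ ⟨a, b, hab, d, hd, Or.inl rfl⟩ (diffHyperplane_ne_sumHyperplane hab)
    have hs0 := fun a b hab => hs a b hab 0 (Or.inl rfl)
    have hs1 := fun a b hab => hs a b hab 1 (Or.inr rfl)
    simp only [Int.cast_zero, Int.cast_one] at hs0 hs1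
    refine ⟨⟨h0, hd s t hst (1 - c) (by omega) (by omega), hs0 s t hst, hs1 s t hst⟩,
      fun a b hab hne => ?_⟩
    have h1 := hd a b hab 0 (Or.inl rfl) (by tauto)
    have h2 := hd a b hab 1 (Or.inr rfl) (by tauto)
    simp only [Int.cast_zero, Int.cast_one] at h1 h2
    exact ⟨hs0 a b hab, hs1 a b hab, h1, h2⟩
  · rintro ⟨⟨h0, h1, h2, h3⟩, h⟩
    refine ⟨h0, ?_⟩
    rintro K ⟨a, b, hab, d, hd, rfl | rfl⟩ hne
    · rw [mem_diffHyperplane_mod]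
      by_cases hh : a = s ∧ b = t
      · obtain ⟨rfl, rfl⟩ := hh
        rcases hd with rfl | rfl
        · simpa using h2
        · simpa using h3
      · have := h a b hab hh
        rcases hd with rfl | rfl
        · simpa using this.1
        · simpa using this.2.1
    · rw [mem_sumHyperplane_mod]
      rw [Ne, sumHyperplane_injective hab hst] at hne
      by_cases hh : a = s ∧ b = t
      · obtain ⟨rfl, rfl⟩ := hh
        obtain rfl : d = 1 - c := by omega
        exact h1
      · have := h a b hab hh
        rcases hd with rfl | rfl
        · simpa using this.2.2.1
        · simpa using this.2.2.2

end Membership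

/-! ### Integer representatives -/

section Representatives

variable {q : ℕ} {K e : ℤ}

/-- The interval of representatives of `ℤ/q`, where `q = 2K - 1 - e`. -/
def InRange (K e v : ℤ) : Prop := -(K - 1 - e) ≤ v ∧ v ≤ K - 1

lemma dvd_iff_of_abs_lt {q d : ℤ} (h : -(2 * q) < d ∧ d < 2 * q) :
    q ∣ d ↔ d = 0 ∨ d = q ∨ d = -q := by
  constructor
  · rintro ⟨k, rfl⟩
    have hq : 0 < q := by omega
    have h1 : -2 < k := by nlinarith
    have h2 : k < 2 := by nlinarith
    obtain rfl | rfl | rfl : k = 0 ∨ k = 1 ∨ k = -1 := by omega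
    all_goals simp
  · rintro (rfl | rfl | rfl) <;> simp

lemma intCast_sub_eq_iff (hq : (q : ℤ) = 2 * K - 1 - e) {u v c : ℤ}
    (hu : InRange K e u) (hv : InRange K e v) (hc : c = 0 ∨ c = 1) :
    (u : ZMod q) - v = c ↔ u - v = c ∨ u - v = c + q ∨ u - v = c - q := by
  unfold InRange at hu hv
  rw [← Int.cast_sub, eq_comm, ZMod.intCast_eq_intCast_iff_dvd_sub, dvd_iff_of_abs_lt (by omega)]
  omega

lemma intCast_add_eq_iff (hq : (q : ℤ) = 2 * K - 1 - e) (he : e = 0 ∨ e = 1) (hK : 3 ≤ K)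
    {u v c : ℤ} (hu : InRange K e u) (hv : InRange K e v) (hc : c = 0 ∨ c = 1) :
    (u : ZMod q) + v = c ↔ u + v = c ∨ u + v = c + q ∨ u + v = c - q := by
  unfold InRange at hu hv
  rw [← Int.cast_add, eq_comm, ZMod.intCast_eq_intCast_iff_dvd_sub, dvd_iff_of_abs_lt (by omega)]
  omega

lemma eq_of_intCast_eq (hq : (q : ℤ) = 2 * K - 1 - e) {u v : ℤ}
    (hu : InRange K e u) (hv : InRange K e v) (h : (u : ZMod q) = v) : u = v := by
  have := (intCast_sub_eq_iff hq hu hv (c := 0) (Or.inl rfl)).1 (by rw [h]; simp)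
  unfold InRange at hu hv
  omega

lemma exists_inRange_cast (hq : (q : ℤ) = 2 * K - 1 - e) (he : e = 0 ∨ e = 1) (hK : 3 ≤ K)
    (x : ZMod q) : ∃ v, InRange K e v ∧ (v : ZMod q) = x := by
  have : NeZero q := ⟨by omega⟩
  refine ⟨x.valMinAbs, ?_, ZMod.coe_valMinAbs x⟩
  have := x.valMinAbs_mem_Ioc
  rw [Set.mem_Ioc] at this
  unfold InRange
  omega

/-- Two labels at signed positions `u` and `v` do not share a position, and if they are adjacent
then their keys increase. -/
def GoodPair (m a u b v : ℤ) : Prop :=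
  |u| ≠ |v| ∧ (|v| = |u| + 1 → signedKey m a u < signedKey m b v) ∧
    (|u| = |v| + 1 → signedKey m b v < signedKey m a u)

lemma GoodPair.symm {m a u b v : ℤ} (h : GoodPair m a u b v) : GoodPair m b v a u :=
  ⟨h.1.symm, h.2.2, h.2.1⟩

/-- The hyperplanes `x ± y = 0` forbid equal positions. Among adjacent positions, `x - y = 1` and
`x + y = 1` forbid exactly those pairs of signed labels whose keys decrease. -/
lemma avoidsShi_iff_goodPair (hq : (q : ℤ) = 2 * K - 1 - e) (he : e = 0 ∨ e = 1) (hK : 3 ≤ K)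
    {m a b u v : ℤ} (hab : a < b) (hb : b < m) (hu : InRange K e u) (hv : InRange K e v) :
    AvoidsShi (u : ZMod q) v ↔ GoodPair m a u b v := by
  have h1 := intCast_sub_eq_iff hq hu hv (Or.inl rfl)
  have h2 := intCast_sub_eq_iff hq hu hv (Or.inr rfl)
  have h3 := intCast_add_eq_iff hq he hK hu hv (Or.inl rfl)
  have h4 := intCast_add_eq_iff hq he hK hu hv (Or.inr rfl)
  rw [Int.cast_zero] at h1 h3
  rw [Int.cast_one] at h2 h4
  unfold AvoidsShi GoodPair signedKey
  rw [Ne, Ne, Ne, Ne, h1, h2, h3, h4, hq]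
  unfold InRange at hu hv
  by_cases hpu : 0 < u <;> by_cases hpv : 0 < v
  · rw [if_pos hpu, if_pos hpv, abs_of_pos hpu, abs_of_pos hpv]; omega
  · rw [if_pos hpu, if_neg hpv, abs_of_pos hpu, abs_of_nonpos (not_lt.1 hpv)]; omega
  · rw [if_neg hpu, if_pos hpv, abs_of_nonpos (not_lt.1 hpu), abs_of_pos hpv]; omega
  · rw [if_neg hpu, if_neg hpv, abs_of_nonpos (not_lt.1 hpu), abs_of_nonpos (not_lt.1 hpv)]; omega

end Representatives

section Blocks

variable {m : ℕ}

/-- The coordinates other than `s` and `t`. -/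
abbrev OtherLabels (s t : Fin m) : Type := {l : Fin m // l ≠ s ∧ l ≠ t}

/-- The label of a coordinate, as an integer. -/
def label {s t : Fin m} (l : OtherLabels s t) : ℤ := (l.1 : ℕ)

lemma label_injective {s t : Fin m} : Function.Injective (label (s := s) (t := t)) := by
  intro l l' h
  unfold label at h
  exact Subtype.ext (Fin.ext (by exact_mod_cast h))

lemma card_otherLabels {s t : Fin m} (hst : s < t) :
    (Fintype.card (OtherLabels s t) : ℤ) = m - 2 := by
  have h : (Finset.univ.filter fun l : Fin m => l ≠ s ∧ l ≠ t) = {s, t}ᶜ := by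
    ext l; simp
  have hc : Fintype.card (OtherLabels s t) = m - 2 := by
    rw [Fintype.card_subtype, h, Finset.card_compl, Finset.card_pair hst.ne, Fintype.card_fin]
  have := t.2
  have : (s : ℕ) < t := hst
  omega

/-- A way in which the coordinates `s` and `t` may form a block: at the position `b`, they are at
the signed positions `xs b` and `xt b`; the first position is excluded if `f₀` holds, and the
last one if `f₁` holds. The conditions on the keys encode the hyperplanes that involve exactly
one of the coordinates `s` and `t`. -/
structure BlockType (s t : Fin m) extends BlockData where
  /-- the signed position of the coordinate `s` -/
  xs : ℤ → ℤ
  /-- the signed position of the coordinate `t` -/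
  xt : ℤ → ℤ
  /-- the block is not allowed to begin at the first position -/
  f₀ : Prop
  /-- the block is not allowed to end at the last position -/
  f₁ : Prop
  M_eq : M = m
  xs_injective : Function.Injective xs
  inRange : ∀ b, 0 ≤ b → b + w < S + (m - 2) → (f₀ → b ≠ 0) → (f₁ → b + w ≠ S + (m - 2) - 1) →
    InRange (S + (m - 2)) e (xs b) ∧ InRange (S + (m - 2)) e (xt b)
  goodPair_iff : ∀ b, 0 ≤ b → (f₀ → b ≠ 0) → ∀ a v : ℤ,
    (GoodPair m a v (s : ℕ) (xs b) ∧ GoodPair m a v (t : ℕ) (xt b) ↔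
      |v| ≠ b ∧ |v| ≠ b + w ∧ (|v| + 1 = b → signedKey m a v < cL) ∧
        (|v| = b + w + 1 → cR < signedKey m a v))

variable {s t : Fin m}

/-- The positions at which a block of the given type may begin. -/
def BlockType.Valid (B : BlockType s t) (b : ℤ) : Prop :=
  0 ≤ b ∧ b + B.w < B.S + (m - 2) ∧ (B.f₀ → b ≠ 0) ∧ (B.f₁ → b + B.w ≠ B.S + (m - 2) - 1)

/-- The integer point given by a block position and the signed positions of the other labels. -/
def BlockType.point (B : BlockType s t) (x : ℤ × (OtherLabels s t → ℤ)) (k : Fin m) : ℤ :=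
  if h : k ≠ s ∧ k ≠ t then x.2 ⟨k, h⟩ else if k = s then B.xs x.1 else B.xt x.1

namespace BlockType

variable (B : BlockType s t)

lemma point_s (x : ℤ × (OtherLabels s t → ℤ)) : B.point x s = B.xs x.1 := by
  simp [point]

lemma point_t (hst : s < t) (x : ℤ × (OtherLabels s t → ℤ)) : B.point x t = B.xt x.1 := by
  simp [point, hst.ne']

lemma point_other (x : ℤ × (OtherLabels s t → ℤ)) (l : OtherLabels s t) :
    B.point x l.1 = x.2 l := by
  simp [point, l.2.1, l.2.2]

lemma point_injective : Function.Injective B.point := by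
  rintro ⟨b, v⟩ ⟨b', v'⟩ h
  have h1 := congrFun h s
  rw [point_s, point_s] at h1
  refine Prod.ext (B.xs_injective h1) (funext fun l => ?_)
  have h2 := congrFun h l.1
  rwa [point_other, point_other] at h2

/-- Block configurations correspond to the integer points in which all pairs of labels other than
the pair `s`, `t` are good. -/
lemma mem_restrictedConfigs_iff (hst : s < t) {x : ℤ × (OtherLabels s t → ℤ)} :
    x ∈ B.restrictedConfigs label B.f₀ B.f₁ ↔
      B.Valid x.1 ∧ (∀ k, InRange (B.S + (m - 2)) B.e (B.point x k)) ∧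
        ∀ a b : Fin m, a ≠ b → ¬(a = s ∧ b = t) → ¬(a = t ∧ b = s) →
          GoodPair m (a : ℕ) (B.point x a) (b : ℕ) (B.point x b) := by
  obtain ⟨p, v⟩ := x
  simp only [BlockData.restrictedConfigs, BlockData.configs, card_otherLabels hst,
    Set.mem_ofPred_eq, Valid, B.M_eq]
  constructor
  · rintro ⟨⟨hr, hadm, h0, hw, hn⟩, hf0, hf1⟩
    refine ⟨⟨h0, hw, hf0, hf1⟩, fun k => ?_, ?_⟩
    · by_cases hk : k ≠ s ∧ k ≠ t
      · have := B.point_other (p, v) ⟨k, hk⟩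
        rw [this]
        exact hr _
      · obtain rfl | rfl : k = s ∨ k = t := by tauto
        · rw [point_s]
          exact (B.inRange p h0 hw hf0 hf1).1
        · rw [point_t B hst]
          exact (B.inRange p h0 hw hf0 hf1).2
    · have key : ∀ l : OtherLabels s t,
          GoodPair m (l.1 : ℕ) (v l) (s : ℕ) (B.xs p) ∧
            GoodPair m (l.1 : ℕ) (v l) (t : ℕ) (B.xt p) :=
        fun l => (B.goodPair_iff p h0 hf0 (l.1 : ℕ) (v l)).2 (hn l)
      intro a b hab h1 h2
      by_cases ha : a ≠ s ∧ a ≠ t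
      · obtain ⟨l, rfl⟩ : ∃ l : OtherLabels s t, l.1 = a := ⟨⟨a, ha⟩, rfl⟩
        rw [point_other]
        by_cases hb : b ≠ s ∧ b ≠ t
        · obtain ⟨l', rfl⟩ : ∃ l : OtherLabels s t, l.1 = b := ⟨⟨b, hb⟩, rfl⟩
          rw [point_other]
          exact ⟨fun h => hab (congrArg Subtype.val (hadm.inj h)), hadm.adj l l', hadm.adj l' l⟩
        · obtain rfl | rfl : b = s ∨ b = t := by tauto
          · rw [point_s]; exact (key l).1
          · rw [point_t B hst]; exact (key l).2
      · obtain ⟨l, rfl⟩ : ∃ l : OtherLabels s t, l.1 = b := ⟨⟨b, by grind⟩, rfl⟩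
        rw [point_other]
        obtain rfl | rfl : a = s ∨ a = t := by tauto
        · rw [point_s]; exact (key l).1.symm
        · rw [point_t B hst]; exact (key l).2.symm
  · rintro ⟨⟨h0, hw, hf0, hf1⟩, hr, hg⟩
    have hgl : ∀ l l' : OtherLabels s t, l ≠ l' →
        GoodPair m (l.1 : ℕ) (v l) (l'.1 : ℕ) (v l') := fun l l' hl => by
      have := hg l.1 l'.1 (fun h => hl (Subtype.ext h)) (fun h => l.2.1 h.1) (fun h => l.2.2 h.1)
      rwa [point_other, point_other] at this
    refine ⟨⟨fun l => ?_, ⟨fun l l' h => ?_, fun l l' h => ?_⟩, h0, hw, fun l => ?_⟩, hf0, hf1⟩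
    · have := hr l.1
      rwa [point_other] at this
    · by_contra hne
      exact (hgl l l' hne).1 h
    · refine (hgl l l' ?_).2.1 h
      rintro rfl
      simp at h
    · have h1 := hg l.1 s l.2.1 (fun h => l.2.1 h.1) (fun h => l.2.2 h.1)
      have h2 := hg l.1 t l.2.2 (fun h => l.2.1 h.1) (fun h => l.2.2 h.1)
      rw [point_other, point_s] at h1
      rw [point_other, point_t B hst] at h2
      exact (B.goodPair_iff p h0 hf0 (l.1 : ℕ) (v l)).1 ⟨h1, h2⟩

end BlockType

/-- If the points of `C` are those in which the coordinates `s` and `t` form a block of one of two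
types and all other pairs of coordinates avoid the arrangement, then counting `C` means counting
block configurations. -/
theorem ncard_eq_add_of_blockTypes {q : ℕ} (hst : s < t) {K e : ℤ}
    (hq : (q : ℤ) = 2 * K - 1 - e) (he : e = 0 ∨ e = 1) (hK : 3 ≤ K)
    (C : Set (Fin m → ZMod q)) (P : ZMod q → ZMod q → Prop)
    (hC : ∀ x, x ∈ C ↔ P (x s) (x t) ∧
      ∀ a b, a < b → ¬(a = s ∧ b = t) → AvoidsShi (x a) (x b))
    (B B' : BlockType s t) (hBK : B.S + (m - 2) = K) (hBe : B.e = e) (hBK' : B'.S + (m - 2) = K)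
    (hBe' : B'.e = e)
    (hP : ∀ u v : ℤ, InRange K e u → InRange K e v → (P u v ↔
      (∃ b, B.Valid b ∧ u = B.xs b ∧ v = B.xt b) ∨ ∃ b, B'.Valid b ∧ u = B'.xs b ∧ v = B'.xt b))
    (hdisj : ∀ b b', B.Valid b → B'.Valid b' → B.xs b = B'.xs b' → B.xt b ≠ B'.xt b') :
    C.ncard = (B.restrictedConfigs (label (s := s) (t := t)) B.f₀ B.f₁).ncard +
      (B'.restrictedConfigs (label (s := s) (t := t)) B'.f₀ B'.f₁).ncard := by
  have : NeZero q := ⟨by omega⟩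
  set F : (Fin m → ℤ) → Fin m → ZMod q := fun u k => u k with hF
  set R := B.restrictedConfigs (label (s := s) (t := t)) B.f₀ B.f₁ with hR
  set R' := B'.restrictedConfigs (label (s := s) (t := t)) B'.f₀ B'.f₁ with hR'
  have mR : ∀ x, x ∈ R ↔ _ := fun x => B.mem_restrictedConfigs_iff hst
  have mR' : ∀ x, x ∈ R' ↔ _ := fun x => B'.mem_restrictedConfigs_iff hst
  rw [hBK, hBe] at mR
  rw [hBK', hBe'] at mR'
  have Finj : ∀ u v : Fin m → ℤ, (∀ k, InRange K e (u k)) → (∀ k, InRange K e (v k)) →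
      F u = F v → u = v := fun u v hu hv h =>
    funext fun k => eq_of_intCast_eq hq (hu k) (hv k) (congrFun h k)
  have hpairs : ∀ u : Fin m → ℤ, (∀ k, InRange K e (u k)) →
      ((∀ a b, a < b → ¬(a = s ∧ b = t) → AvoidsShi (F u a) (F u b)) ↔
        ∀ a b : Fin m, a ≠ b → ¬(a = s ∧ b = t) → ¬(a = t ∧ b = s) →
          GoodPair m (a : ℕ) (u a) (b : ℕ) (u b)) := by
    intro u hu
    have h1 : ∀ a b : Fin m, a < b → (AvoidsShi (F u a) (F u b) ↔
        GoodPair m (a : ℕ) (u a) (b : ℕ) (u b)) := fun a b hab =>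
      avoidsShi_iff_goodPair hq he hK (by exact_mod_cast hab) (by exact_mod_cast b.2) (hu a) (hu b)
    constructor
    · intro h a b hab h2 h3
      rcases lt_or_gt_of_ne hab with hlt | hlt
      · exact (h1 a b hlt).1 (h a b hlt h2)
      · exact ((h1 b a hlt).1 (h b a hlt fun h => h3 h.symm)).symm
    · intro h a b hab h2
      exact (h1 a b hab).2 (h a b hab.ne h2 fun h3 => by
        rw [h3.1, h3.2] at hab
        exact absurd hab hst.not_gt)
  have hunion : C = (fun x => F (B.point x)) '' R ∪ (fun x => F (B'.point x)) '' R' := by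
    ext x
    simp only [Set.mem_union, Set.mem_image, mR, mR']
    constructor
    · intro hx
      choose u hu hux using fun k => exists_inRange_cast hq he hK (x k)
      obtain rfl : F u = x := funext hux
      rw [hC, hpairs u hu] at hx
      have hpt : ∀ (A : BlockType s t) (b : ℤ), u s = A.xs b → u t = A.xt b →
          A.point (b, fun l => u l.1) = u := by
        intro A b h1 h2
        funext k
        by_cases hk : k ≠ s ∧ k ≠ t
        · exact A.point_other (b, fun l => u l.1) ⟨k, hk⟩
        · obtain rfl | rfl : k = s ∨ k = t := by tauto
          · rw [A.point_s, h1]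
          · rw [A.point_t hst, h2]
      rcases (hP _ _ (hu s) (hu t)).1 hx.1 with ⟨b, hb, h1, h2⟩ | ⟨b, hb, h1, h2⟩
      · refine Or.inl ⟨(b, fun l => u l.1), ?_, by rw [hpt B b h1 h2]⟩
        rw [hpt B b h1 h2]
        exact ⟨hb, hu, hx.2⟩
      · refine Or.inr ⟨(b, fun l => u l.1), ?_, by rw [hpt B' b h1 h2]⟩
        rw [hpt B' b h1 h2]
        exact ⟨hb, hu, hx.2⟩
    · rintro (⟨y, ⟨h1, h2, h3⟩, rfl⟩ | ⟨y, ⟨h1, h2, h3⟩, rfl⟩)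
      · exact (hC _).2 ⟨(hP _ _ (h2 s) (h2 t)).2
          (Or.inl ⟨y.1, h1, B.point_s y, B.point_t hst y⟩), (hpairs _ h2).2 h3⟩
      · exact (hC _).2 ⟨(hP _ _ (h2 s) (h2 t)).2
          (Or.inr ⟨y.1, h1, B'.point_s y, B'.point_t hst y⟩), (hpairs _ h2).2 h3⟩
  have hd : Disjoint ((fun x => F (B.point x)) '' R) ((fun x => F (B'.point x)) '' R') := by
    rw [Set.disjoint_left]
    rintro _ ⟨x, hx, rfl⟩ ⟨y, hy, hxy⟩
    rw [mR] at hx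
    rw [mR'] at hy
    have h := Finj _ _ hx.2.1 hy.2.1 hxy.symm
    refine hdisj x.1 y.1 hx.1 hy.1 ?_ ?_
    · rw [← B.point_s, ← B'.point_s, h]
    · rw [← B.point_t hst, ← B'.point_t hst, h]
  rw [hunion, Set.ncard_union_eq hd, Set.InjOn.ncard_image, Set.InjOn.ncard_image]
  · intro x hx y hy hxy
    exact B'.point_injective (Finj _ _ ((mR' x).1 hx).2.1 ((mR' y).1 hy).2.1 hxy)
  · intro x hx y hy hxy
    exact B.point_injective (Finj _ _ ((mR x).1 hx).2.1 ((mR y).1 hy).2.1 hxy)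

end Blocks

/-! ### The eight block types -/

lemma goodPair_iff_of_pos {m a v b y : ℤ} (hy : 0 < y) :
    GoodPair m a v b y ↔ |v| ≠ y ∧ (y = |v| + 1 → signedKey m a v < b) ∧
      (|v| = y + 1 → b < signedKey m a v) := by
  have : signedKey m b y = b := if_pos hy
  rw [GoodPair, abs_of_pos hy, this]

lemma goodPair_iff_of_nonpos {m a v b y : ℤ} (hy : y ≤ 0) :
    GoodPair m a v b y ↔ |v| ≠ -y ∧ (-y = |v| + 1 → signedKey m a v < 2 * m - b) ∧
      (|v| = -y + 1 → 2 * m - b < signedKey m a v) := by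
  have : signedKey m b y = 2 * m - b := if_neg hy.not_gt
  rw [GoodPair, abs_of_nonpos hy, this]

section Types

variable {m : ℕ} {s t : Fin m} (hst : s < t) (S e : ℤ) (he : e = 0 ∨ e = 1)

/-- The coordinates `s` and `t` are equal and positive. -/
def equalPos : BlockType s t where
  M := m
  S := S
  e := e
  w := 0
  cL := (s : ℕ)
  cR := (t : ℕ)
  e_mem := he
  w_mem := Or.inl rfl
  xs b := b
  xt b := b
  f₀ := True
  f₁ := e = 1
  M_eq := rfl
  xs_injective := fun _ _ h => h
  inRange b h0 h1 h2 h3 := by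
    have := h2 trivial
    unfold InRange; omega
  goodPair_iff b h0 h2 a v := by
    have := h2 trivial
    have : (s : ℕ) < t := hst
    rw [goodPair_iff_of_pos (by omega), goodPair_iff_of_pos (by omega)]
    omega

/-- The coordinates `s` and `t` are equal and negative. -/
def equalNeg : BlockType s t where
  M := m
  S := S
  e := e
  w := 0
  cL := 2 * m - (t : ℕ)
  cR := 2 * m - (s : ℕ)
  e_mem := he
  w_mem := Or.inl rfl
  xs b := -b
  xt b := -b
  f₀ := True
  f₁ := True
  M_eq := rfl
  xs_injective := neg_injective
  inRange b h0 h1 h2 h3 := by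
    have := h2 trivial
    have := h3 trivial
    unfold InRange; omega
  goodPair_iff b h0 h2 a v := by
    have : (s : ℕ) < t := hst
    rw [goodPair_iff_of_nonpos (by omega), goodPair_iff_of_nonpos (by omega)]
    omega

/-- The coordinates `s` and `t` are opposite, and the coordinate `s` is positive. -/
def oppositePos : BlockType s t where
  M := m
  S := S
  e := e
  w := 0
  cL := (s : ℕ)
  cR := 2 * m - (t : ℕ)
  e_mem := he
  w_mem := Or.inl rfl
  xs b := b
  xt b := -b
  f₀ := True
  f₁ := e = 1
  M_eq := rfl
  xs_injective := fun _ _ h => h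
  inRange b h0 h1 h2 h3 := by
    have := h2 trivial
    unfold InRange; omega
  goodPair_iff b h0 h2 a v := by
    have := h2 trivial
    have : (s : ℕ) < t := hst
    rw [goodPair_iff_of_pos (by omega), goodPair_iff_of_nonpos (by omega)]
    omega

/-- The coordinates `s` and `t` are opposite, and the coordinate `s` is negative. -/
def oppositeNeg : BlockType s t where
  M := m
  S := S
  e := e
  w := 0
  cL := (t : ℕ)
  cR := 2 * m - (s : ℕ)
  e_mem := he
  w_mem := Or.inl rfl
  xs b := -b
  xt b := b
  f₀ := True
  f₁ := True
  M_eq := rfl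
  xs_injective := neg_injective
  inRange b h0 h1 h2 h3 := by
    have := h2 trivial
    have := h3 trivial
    unfold InRange; omega
  goodPair_iff b h0 h2 a v := by
    have := h2 trivial
    have : (s : ℕ) < t := hst
    rw [goodPair_iff_of_nonpos (by omega), goodPair_iff_of_pos (by omega)]
    omega

/-- The coordinate `s` is one more than the coordinate `t`, and both are positive. -/
def succPos : BlockType s t where
  M := m
  S := S
  e := e
  w := 1
  cL := (t : ℕ)
  cR := (s : ℕ)
  e_mem := he
  w_mem := Or.inr rfl
  xs b := b + 1
  xt b := b
  f₀ := True
  f₁ := False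
  M_eq := rfl
  xs_injective := add_left_injective 1
  inRange b h0 h1 h2 h3 := by
    have := h2 trivial
    unfold InRange; omega
  goodPair_iff b h0 h2 a v := by
    have := h2 trivial
    rw [goodPair_iff_of_pos (by omega), goodPair_iff_of_pos (by omega)]
    omega

/-- The coordinate `s` is one more than the coordinate `t`, and both are nonpositive. -/
def succNeg : BlockType s t where
  M := m
  S := S
  e := e
  w := 1
  cL := 2 * m - (s : ℕ)
  cR := 2 * m - (t : ℕ)
  e_mem := he
  w_mem := Or.inr rfl
  xs b := -b
  xt b := -(b + 1)
  f₀ := False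
  f₁ := e = 1
  M_eq := rfl
  xs_injective := neg_injective
  inRange b h0 h1 h2 h3 := by
    unfold InRange; omega
  goodPair_iff b h0 h2 a v := by
    rw [goodPair_iff_of_nonpos (by omega), goodPair_iff_of_nonpos (by omega)]
    omega

/-- The coordinates `s` and `t` have sum one, and the coordinate `s` is nonpositive. -/
def sumOneNeg : BlockType s t where
  M := m
  S := S
  e := e
  w := 1
  cL := 2 * m - (s : ℕ)
  cR := (t : ℕ)
  e_mem := he
  w_mem := Or.inr rfl
  xs b := -b
  xt b := b + 1
  f₀ := False
  f₁ := e = 1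
  M_eq := rfl
  xs_injective := neg_injective
  inRange b h0 h1 h2 h3 := by
    unfold InRange; omega
  goodPair_iff b h0 h2 a v := by
    rw [goodPair_iff_of_nonpos (by omega), goodPair_iff_of_pos (by omega)]
    omega

/-- The coordinates `s` and `t` have sum one, and the coordinate `s` is positive. -/
def sumOnePos : BlockType s t where
  M := m
  S := S
  e := e
  w := 1
  cL := 2 * m - (t : ℕ)
  cR := (s : ℕ)
  e_mem := he
  w_mem := Or.inr rfl
  xs b := b + 1
  xt b := -b
  f₀ := True
  f₁ := False
  M_eq := rfl
  xs_injective := add_left_injective 1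
  inRange b h0 h1 h2 h3 := by
    unfold InRange; omega
  goodPair_iff b h0 h2 a v := by
    rw [goodPair_iff_of_pos (by omega), goodPair_iff_of_nonpos (by omega)]
    omega

end Types

section Products

lemma sum_Ico_eq_of_const {f : ℤ → ℤ} {n c : ℤ} (hn : 2 ≤ n)
    (h : ∀ β, 1 ≤ β → β < n - 1 → f β = c) :
    ∑ β ∈ Finset.Ico 0 n, f β = f 0 + (n - 2) * c + f (n - 1) := by
  have h1 : Finset.Ico 0 n = insert 0 (insert (n - 1) (Finset.Ico 1 (n - 1))) := by
    ext β
    simp only [Finset.mem_insert, Finset.mem_Ico]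
    omega
  rw [h1, Finset.sum_insert (by simp; omega), Finset.sum_insert (by simp),
    Finset.sum_congr rfl fun β hβ => h β (Finset.mem_Ico.1 hβ).1 (Finset.mem_Ico.1 hβ).2,
    Finset.sum_const, Int.card_Ico, nsmul_eq_mul, show n - 1 - 1 = n - 2 by ring,
    Int.toNat_of_nonneg (by omega)]
  ring

variable {m : ℕ} {s t : Fin m}

/-- The product of a function of the labels other than `s` and `t` that takes the value `x` below
`s`, the value `y` between `s` and `t`, and the value `z` above `t`. -/
def classProd (s t : Fin m) (x y z : ℤ) : ℤ :=
  x ^ (s : ℕ) * y ^ ((t : ℕ) - s - 1) * z ^ (m - 1 - t)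

lemma prod_otherLabels (hst : s < t) {f : ℤ → ℤ} {x y z : ℤ}
    (hx : ∀ a : ℤ, 0 ≤ a → a < (s : ℕ) → f a = x)
    (hy : ∀ a : ℤ, (s : ℕ) < a → a < (t : ℕ) → f a = y)
    (hz : ∀ a : ℤ, (t : ℕ) < a → a < m → f a = z) :
    ∏ l : OtherLabels s t, f (label l) = classProd s t x y z := by
  have hst' : (s : ℕ) < t := hst
  have htm := t.2
  set g : ℕ → ℤ := fun k => if k ≠ s ∧ k ≠ t then f k else 1 with hg
  have h1 : ∏ l : OtherLabels s t, f (label l) = ∏ k ∈ Finset.range m, g k := by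
    have hsub : ∏ k ∈ Finset.univ.filter (fun l : Fin m => l ≠ s ∧ l ≠ t), f (k : ℕ) =
        ∏ l : OtherLabels s t, f (label l) := Finset.prod_subtype _ (by simp) _
    rw [Finset.prod_range, ← hsub, Finset.prod_filter]
    refine Finset.prod_congr rfl fun k _ => ?_
    simp only [hg, Ne, Fin.ext_iff]
  have h2 : ∏ k ∈ Finset.Ico 0 (s : ℕ), g k = x ^ (s : ℕ) := by
    rw [Finset.prod_congr rfl (g := fun _ => x), Finset.prod_const, Nat.card_Ico, Nat.sub_zero]
    intro k hk
    rw [Finset.mem_Ico] at hk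
    simp only [hg]
    rw [if_pos (by omega)]
    exact hx k (by omega) (by omega)
  have h3 : ∏ k ∈ Finset.Ico ((s : ℕ) + 1) t, g k = y ^ ((t : ℕ) - s - 1) := by
    rw [Finset.prod_congr rfl (g := fun _ => y), Finset.prod_const, Nat.card_Ico, Nat.sub_sub]
    intro k hk
    rw [Finset.mem_Ico] at hk
    simp only [hg]
    rw [if_pos (by omega)]
    exact hy k (by omega) (by omega)
  have h4 : ∏ k ∈ Finset.Ico ((t : ℕ) + 1) m, g k = z ^ (m - 1 - t) := by
    rw [Finset.prod_congr rfl (g := fun _ => z), Finset.prod_const, Nat.card_Ico, Nat.sub_sub,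
      add_comm 1]
    intro k hk
    rw [Finset.mem_Ico] at hk
    simp only [hg]
    rw [if_pos (by omega)]
    exact hz k (by omega) (by omega)
  rw [h1, Finset.range_eq_Ico, ← Finset.prod_Ico_consecutive g (Nat.zero_le s) s.2.le,
    Finset.prod_eq_prod_Ico_succ_bot s.2, ← Finset.prod_Ico_consecutive g hst' htm.le,
    Finset.prod_eq_prod_Ico_succ_bot htm, h2, h3, h4]
  simp [hg, classProd]
  ring

/-- The number of configurations of a block type. All interior separators contribute the same amount
`c`; the first and the last one contribute `z₀` and `z₁`, from which the configurations with the
block at an excluded position are already removed. -/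
lemma BlockType.ncard_eq (B : BlockType s t) {S w : ℤ} (hBS : B.S = S) (hBw : B.w = w)
    (hS : w + 2 ≤ S) {c z₀ z₁ : ℤ}
    (hc : ∀ β, 1 ≤ β → β < S - w - 1 → ∏ l : OtherLabels s t, B.slotCount β (label l) = c)
    (h₀ : (B.f₀ ∧ ∏ l : OtherLabels s t, B.slotCount 0 (label l) -
        ∏ l : OtherLabels s t, B.noLeft.slotCount 0 (label l) = z₀) ∨
      (¬B.f₀ ∧ ∏ l : OtherLabels s t, B.slotCount 0 (label l) = z₀))
    (h₁ : (B.f₁ ∧ ∏ l : OtherLabels s t, B.slotCount (S - 1 - w) (label l) -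
        ∏ l : OtherLabels s t, B.noRight.slotCount (S - 1 - w) (label l) = z₁) ∨
      (¬B.f₁ ∧ ∏ l : OtherLabels s t, B.slotCount (S - 1 - w) (label l) = z₁)) :
    ((B.restrictedConfigs (label (s := s) (t := t)) B.f₀ B.f₁).ncard : ℤ) =
      z₀ + (S - w - 2) * c + z₁ := by
  classical
  subst hBS hBw
  rw [B.toBlockData.ncard_restrictedConfigs label_injective, sum_Ico_eq_of_const (by omega) hc,
    sub_right_comm B.S B.w 1]
  · rcases h₀ with ⟨h, rfl⟩ | ⟨h, rfl⟩ <;> rcases h₁ with ⟨h', rfl⟩ | ⟨h', rfl⟩ <;>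
      simp only [h, h', if_true, if_false] <;> ring
  · intro l
    rw [B.M_eq]
    have := l.1.2
    unfold label
    omega
  · intro l
    unfold label
    omega
  · omega

end Products

/-! ### Counts for the block types -/

section Counts

variable {m : ℕ} {s t : Fin m} (hst : s < t) {S e τ : ℤ} (he : e = 0 ∨ e = 1)

lemma ncard_equalPos (hτ : τ = 2 * S + 1 - e) (hS : 2 ≤ S) :
    (((equalPos hst S e he).restrictedConfigs (label (s := s) (t := t))
      (equalPos hst S e he).f₀ (equalPos hst S e he).f₁).ncard : ℤ) =
      (S - 1) * classProd s t (τ - 2) (τ - 3) (τ - 2) -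
        if e = 1 then classProd s t (τ - 2) (τ - 3) (τ - 3) else 0 := by
  have hst' : (s : ℕ) < t := hst
  have htm := t.2
  have hc : ∀ β, 1 ≤ β → β ≤ S - 1 →
      ∏ l : OtherLabels s t, (equalPos hst S e he).slotCount β (label l) =
        classProd s t (τ - 2) (τ - 3) (τ - 2) := by
    intro β h1 h2
    apply prod_otherLabels hst <;> intros <;>
      simp only [BlockData.slotCount, equalPos] <;> split_ifs <;> omega
  refine ((equalPos hst S e he).ncard_eq (S := S) (w := 0)
    (z₀ := 0)
    (z₁ := if e = 1 then classProd s t (τ - 2) (τ - 3) (τ - 2) -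
        classProd s t (τ - 2) (τ - 3) (τ - 3) else
        classProd s t (τ - 2) (τ - 3) (τ - 2))
    rfl rfl (by omega) (fun β h1 h2 => hc β (by omega) (by omega)) ?_ ?_).trans ?_
  · refine Or.inl ⟨trivial, sub_eq_zero.2 ?_⟩
    refine Finset.prod_congr rfl fun l _ => ?_
    have := l.1.2
    simp only [BlockData.slotCount, BlockData.noLeft, equalPos, label]
    split_ifs <;> omega
  · split_ifs with h
    · refine Or.inl ⟨h, ?_⟩
      rw [hc _ (by omega) (by omega)]
      congr 1
      apply prod_otherLabels hst <;> intros <;>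
        simp only [BlockData.slotCount, BlockData.noRight, equalPos] <;> split_ifs <;> omega
    · exact Or.inr ⟨h, hc _ (by omega) (by omega)⟩
  · rcases he with rfl | rfl <;> simp only [if_true, zero_ne_one, if_false] <;> ring

lemma ncard_equalNeg (hτ : τ = 2 * S + 1 - e) (hS : 2 ≤ S) :
    (((equalNeg hst S e he).restrictedConfigs (label (s := s) (t := t))
      (equalNeg hst S e he).f₀ (equalNeg hst S e he).f₁).ncard : ℤ) =
      (S - e) * classProd s t (τ - 2) (τ - 3) (τ - 2) - classProd s t (τ - 2) (τ - 3) (τ - 3) -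
        if e = 1 then 0 else classProd s t (τ - 3) (τ - 3) (τ - 2) := by
  have hst' : (s : ℕ) < t := hst
  have htm := t.2
  have hc : ∀ β, 0 ≤ β → (β < S - 1 ∨ e = 0 ∧ β = S - 1) →
      ∏ l : OtherLabels s t, (equalNeg hst S e he).slotCount β (label l) =
        classProd s t (τ - 2) (τ - 3) (τ - 2) := by
    intro β h1 h2
    apply prod_otherLabels hst <;> intros <;>
      simp only [BlockData.slotCount, equalNeg] <;> split_ifs <;> omega
  refine ((equalNeg hst S e he).ncard_eq (S := S) (w := 0)
    (z₀ := classProd s t (τ - 2) (τ - 3) (τ - 2) -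
        classProd s t (τ - 2) (τ - 3) (τ - 3))
    (z₁ := if e = 1 then 0 else
        classProd s t (τ - 2) (τ - 3) (τ - 2) -
        classProd s t (τ - 3) (τ - 3) (τ - 2))
    rfl rfl (by omega) (fun β h1 h2 => hc β (by omega) (by omega)) ?_ ?_).trans ?_
  · refine Or.inl ⟨trivial, ?_⟩
    rw [hc 0 le_rfl (by omega)]
    congr 1
    apply prod_otherLabels hst <;> intros <;>
      simp only [BlockData.slotCount, BlockData.noLeft, equalNeg] <;> split_ifs <;> omega
  · split_ifs with h
    · refine Or.inl ⟨trivial, sub_eq_zero.2 ?_⟩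
      refine Finset.prod_congr rfl fun l _ => ?_
      have := l.1.2
      simp only [BlockData.slotCount, BlockData.noRight, equalNeg, label]
      split_ifs <;> omega
    · refine Or.inl ⟨trivial, ?_⟩
      rw [hc _ (by omega) (by omega)]
      congr 1
      apply prod_otherLabels hst <;> intros <;>
        simp only [BlockData.slotCount, BlockData.noRight, equalNeg] <;> split_ifs <;> omega
  · rcases he with rfl | rfl <;> simp only [if_true, zero_ne_one, if_false] <;> ring

lemma ncard_oppositePos (hτ : τ = 2 * S + 1 - e) (hS : 2 ≤ S) :
    (((oppositePos hst S e he).restrictedConfigs (label (s := s) (t := t))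
      (oppositePos hst S e he).f₀ (oppositePos hst S e he).f₁).ncard : ℤ) =
      (S - 1 - e) * classProd s t (τ - 2) (τ - 3) (τ - 4) := by
  have hst' : (s : ℕ) < t := hst
  have htm := t.2
  have hc : ∀ β, 1 ≤ β → (β < S - 1 ∨ e = 0 ∧ β = S - 1) →
      ∏ l : OtherLabels s t, (oppositePos hst S e he).slotCount β (label l) =
        classProd s t (τ - 2) (τ - 3) (τ - 4) := by
    intro β h1 h2
    apply prod_otherLabels hst <;> intros <;>
      simp only [BlockData.slotCount, oppositePos] <;> split_ifs <;> omega
  refine ((oppositePos hst S e he).ncard_eq (S := S) (w := 0)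
    (z₀ := 0)
    (z₁ := if e = 1 then 0 else
        classProd s t (τ - 2) (τ - 3) (τ - 4))
    rfl rfl (by omega) (fun β h1 h2 => hc β (by omega) (by omega)) ?_ ?_).trans ?_
  · refine Or.inl ⟨trivial, sub_eq_zero.2 ?_⟩
    refine Finset.prod_congr rfl fun l _ => ?_
    have := l.1.2
    simp only [BlockData.slotCount, BlockData.noLeft, oppositePos, label]
    split_ifs <;> omega
  · split_ifs with h
    · refine Or.inl ⟨h, sub_eq_zero.2 ?_⟩
      refine Finset.prod_congr rfl fun l _ => ?_
      have := l.1.2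
      simp only [BlockData.slotCount, BlockData.noRight, oppositePos, label]
      split_ifs <;> omega
    · exact Or.inr ⟨h, hc _ (by omega) (by omega)⟩
  · rcases he with rfl | rfl <;> simp only [if_true, zero_ne_one, if_false] <;> ring

lemma ncard_oppositeNeg (hτ : τ = 2 * S + 1 - e) (hS : 2 ≤ S) :
    (((oppositeNeg hst S e he).restrictedConfigs (label (s := s) (t := t))
      (oppositeNeg hst S e he).f₀ (oppositeNeg hst S e he).f₁).ncard : ℤ) =
      (S - 1 - e) * classProd s t (τ - 2) (τ - 3) (τ - 4) -
        if e = 1 then 0 else classProd s t (τ - 3) (τ - 3) (τ - 4) := by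
  have hst' : (s : ℕ) < t := hst
  have htm := t.2
  have hc : ∀ β, 1 ≤ β → (β < S - 1 ∨ e = 0 ∧ β = S - 1) →
      ∏ l : OtherLabels s t, (oppositeNeg hst S e he).slotCount β (label l) =
        classProd s t (τ - 2) (τ - 3) (τ - 4) := by
    intro β h1 h2
    apply prod_otherLabels hst <;> intros <;>
      simp only [BlockData.slotCount, oppositeNeg] <;> split_ifs <;> omega
  refine ((oppositeNeg hst S e he).ncard_eq (S := S) (w := 0)
    (z₀ := 0)
    (z₁ := if e = 1 then 0 else
        classProd s t (τ - 2) (τ - 3) (τ - 4) -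
        classProd s t (τ - 3) (τ - 3) (τ - 4))
    rfl rfl (by omega) (fun β h1 h2 => hc β (by omega) (by omega)) ?_ ?_).trans ?_
  · refine Or.inl ⟨trivial, sub_eq_zero.2 ?_⟩
    refine Finset.prod_congr rfl fun l _ => ?_
    have := l.1.2
    simp only [BlockData.slotCount, BlockData.noLeft, oppositeNeg, label]
    split_ifs <;> omega
  · split_ifs with h
    · refine Or.inl ⟨trivial, sub_eq_zero.2 ?_⟩
      refine Finset.prod_congr rfl fun l _ => ?_
      have := l.1.2
      simp only [BlockData.slotCount, BlockData.noRight, oppositeNeg, label]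
      split_ifs <;> omega
    · refine Or.inl ⟨trivial, ?_⟩
      rw [hc _ (by omega) (by omega)]
      congr 1
      apply prod_otherLabels hst <;> intros <;>
        simp only [BlockData.slotCount, BlockData.noRight, oppositeNeg] <;> split_ifs <;> omega
  · rcases he with rfl | rfl <;> simp only [if_true, zero_ne_one, if_false] <;> ring

lemma ncard_succPos (hτ : τ = 2 * S + 1 - e) (hS : 3 ≤ S) :
    (((succPos hst S e he).restrictedConfigs (label (s := s) (t := t))
      (succPos hst S e he).f₀ (succPos hst S e he).f₁).ncard : ℤ) =
      (S - 2) * classProd s t (τ - 4) (τ - 3) (τ - 4) := by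
  have hst' : (s : ℕ) < t := hst
  have htm := t.2
  have hc : ∀ β, 1 ≤ β → β ≤ S - 1 - 1 →
      ∏ l : OtherLabels s t, (succPos hst S e he).slotCount β (label l) =
        classProd s t (τ - 4) (τ - 3) (τ - 4) := by
    intro β h1 h2
    apply prod_otherLabels hst <;> intros <;>
      simp only [BlockData.slotCount, succPos] <;> split_ifs <;> omega
  refine ((succPos hst S e he).ncard_eq (S := S) (w := 1)
    (z₀ := 0)
    (z₁ := classProd s t (τ - 4) (τ - 3) (τ - 4))
    rfl rfl (by omega) (fun β h1 h2 => hc β (by omega) (by omega)) ?_ ?_).trans ?_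
  · refine Or.inl ⟨trivial, sub_eq_zero.2 ?_⟩
    refine Finset.prod_congr rfl fun l _ => ?_
    have := l.1.2
    simp only [BlockData.slotCount, BlockData.noLeft, succPos, label]
    split_ifs <;> omega
  · exact Or.inr ⟨id, hc _ (by omega) (by omega)⟩
  · ring

lemma ncard_succNeg (hτ : τ = 2 * S + 1 - e) (hS : 3 ≤ S) :
    (((succNeg hst S e he).restrictedConfigs (label (s := s) (t := t))
      (succNeg hst S e he).f₀ (succNeg hst S e he).f₁).ncard : ℤ) =
      (S - 1 - e) * classProd s t (τ - 4) (τ - 3) (τ - 4) := by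
  have hst' : (s : ℕ) < t := hst
  have htm := t.2
  have hc : ∀ β, 0 ≤ β → (β < S - 1 - 1 ∨ e = 0 ∧ β = S - 1 - 1) →
      ∏ l : OtherLabels s t, (succNeg hst S e he).slotCount β (label l) =
        classProd s t (τ - 4) (τ - 3) (τ - 4) := by
    intro β h1 h2
    apply prod_otherLabels hst <;> intros <;>
      simp only [BlockData.slotCount, succNeg] <;> split_ifs <;> omega
  refine ((succNeg hst S e he).ncard_eq (S := S) (w := 1)
    (z₀ := classProd s t (τ - 4) (τ - 3) (τ - 4))
    (z₁ := if e = 1 then 0 else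
        classProd s t (τ - 4) (τ - 3) (τ - 4))
    rfl rfl (by omega) (fun β h1 h2 => hc β (by omega) (by omega)) ?_ ?_).trans ?_
  · exact Or.inr ⟨id, hc 0 le_rfl (by omega)⟩
  · split_ifs with h
    · refine Or.inl ⟨h, sub_eq_zero.2 ?_⟩
      refine Finset.prod_congr rfl fun l _ => ?_
      have := l.1.2
      simp only [BlockData.slotCount, BlockData.noRight, succNeg, label]
      split_ifs <;> omega
    · exact Or.inr ⟨h, hc _ (by omega) (by omega)⟩
  · rcases he with rfl | rfl <;> simp only [if_true, zero_ne_one, if_false] <;> ring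

lemma ncard_sumOneNeg (hτ : τ = 2 * S + 1 - e) (hS : 3 ≤ S) :
    (((sumOneNeg hst S e he).restrictedConfigs (label (s := s) (t := t))
      (sumOneNeg hst S e he).f₀ (sumOneNeg hst S e he).f₁).ncard : ℤ) =
      (S - 1) * classProd s t (τ - 4) (τ - 3) (τ - 2) -
        if e = 1 then classProd s t (τ - 4) (τ - 3) (τ - 3) else 0 := by
  have hst' : (s : ℕ) < t := hst
  have htm := t.2
  have hc : ∀ β, 0 ≤ β → β ≤ S - 1 - 1 →
      ∏ l : OtherLabels s t, (sumOneNeg hst S e he).slotCount β (label l) =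
        classProd s t (τ - 4) (τ - 3) (τ - 2) := by
    intro β h1 h2
    apply prod_otherLabels hst <;> intros <;>
      simp only [BlockData.slotCount, sumOneNeg] <;> split_ifs <;> omega
  refine ((sumOneNeg hst S e he).ncard_eq (S := S) (w := 1)
    (z₀ := classProd s t (τ - 4) (τ - 3) (τ - 2))
    (z₁ := if e = 1 then classProd s t (τ - 4) (τ - 3) (τ - 2) -
        classProd s t (τ - 4) (τ - 3) (τ - 3) else
        classProd s t (τ - 4) (τ - 3) (τ - 2))
    rfl rfl (by omega) (fun β h1 h2 => hc β (by omega) (by omega)) ?_ ?_).trans ?_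
  · exact Or.inr ⟨id, hc 0 le_rfl (by omega)⟩
  · split_ifs with h
    · refine Or.inl ⟨h, ?_⟩
      rw [hc _ (by omega) (by omega)]
      congr 1
      apply prod_otherLabels hst <;> intros <;>
        simp only [BlockData.slotCount, BlockData.noRight, sumOneNeg] <;> split_ifs <;> omega
    · exact Or.inr ⟨h, hc _ (by omega) (by omega)⟩
  · rcases he with rfl | rfl <;> simp only [if_true, zero_ne_one, if_false] <;> ring

lemma ncard_sumOnePos (hτ : τ = 2 * S + 1 - e) (hS : 3 ≤ S) :
    (((sumOnePos hst S e he).restrictedConfigs (label (s := s) (t := t))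
      (sumOnePos hst S e he).f₀ (sumOnePos hst S e he).f₁).ncard : ℤ) =
      (S - 1) * classProd s t (τ - 4) (τ - 3) (τ - 2) - classProd s t (τ - 4) (τ - 3) (τ - 3) := by
  have hst' : (s : ℕ) < t := hst
  have htm := t.2
  have hc : ∀ β, 0 ≤ β → β ≤ S - 1 - 1 →
      ∏ l : OtherLabels s t, (sumOnePos hst S e he).slotCount β (label l) =
        classProd s t (τ - 4) (τ - 3) (τ - 2) := by
    intro β h1 h2
    apply prod_otherLabels hst <;> intros <;>
      simp only [BlockData.slotCount, sumOnePos] <;> split_ifs <;> omega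
  refine ((sumOnePos hst S e he).ncard_eq (S := S) (w := 1)
    (z₀ := classProd s t (τ - 4) (τ - 3) (τ - 2) -
        classProd s t (τ - 4) (τ - 3) (τ - 3))
    (z₁ := classProd s t (τ - 4) (τ - 3) (τ - 2))
    rfl rfl (by omega) (fun β h1 h2 => hc β (by omega) (by omega)) ?_ ?_).trans ?_
  · refine Or.inl ⟨trivial, ?_⟩
    rw [hc 0 le_rfl (by omega)]
    congr 1
    apply prod_otherLabels hst <;> intros <;>
      simp only [BlockData.slotCount, BlockData.noLeft, sumOnePos] <;> split_ifs <;> omega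
  · exact Or.inr ⟨id, hc _ (by omega) (by omega)⟩
  · ring

end Counts

/-! ### Counts for the four hyperplanes -/

section Restrictions

variable {m q : ℕ} {s t : Fin m} {S e τ : ℤ}

lemma ncard_restriction_diff_zero (hst : s < t) (he : e = 0 ∨ e = 1)
    (hτ : τ = 2 * S + 1 - e) (hq : (q : ℤ) = τ + 2 * m - 6) (hS : 4 ≤ S) :
    ((restrictionComplement (shiD m) (diffHyperplane s t 0) q).ncard : ℤ) =
      ((S - 1) * classProd s t (τ - 2) (τ - 3) (τ - 2) -
        if e = 1 then classProd s t (τ - 2) (τ - 3) (τ - 3) else 0) +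
      ((S - e) * classProd s t (τ - 2) (τ - 3) (τ - 2) - classProd s t (τ - 2) (τ - 3) (τ - 3) -
        if e = 1 then 0 else classProd s t (τ - 3) (τ - 3) (τ - 2)) := by
  have hst' : (s : ℕ) < t := hst
  have htm := t.2
  have hq' : (q : ℤ) = 2 * (S + (m - 2)) - 1 - e := by omega
  rw [← ncard_equalPos hst he hτ (by omega), ← ncard_equalNeg hst he hτ (by omega)]
  exact_mod_cast ncard_eq_add_of_blockTypes hst hq' he (by omega) _
    (fun x y => x - y = ((0 : ℤ) : ZMod q) ∧ x - y ≠ ((1 - 0 : ℤ) : ZMod q) ∧ x + y ≠ 0 ∧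
      x + y ≠ 1)
    (fun x => mem_restrictionComplement_diff hst (Or.inl rfl))
    (equalPos hst S e he) (equalNeg hst S e he) rfl rfl rfl rfl (by
      intro u v hu hv
      have h1 := intCast_sub_eq_iff hq' hu hv (c := 0) (Or.inl rfl)
      have h2 := intCast_sub_eq_iff hq' hu hv (c := 1 - 0) (Or.inr rfl)
      have h3 := intCast_add_eq_iff hq' he (by omega) hu hv (Or.inl rfl)
      have h4 := intCast_add_eq_iff hq' he (by omega) hu hv (Or.inr rfl)
      rw [Int.cast_zero] at h3
      rw [Int.cast_one] at h4
      unfold InRange at hu hv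
      simp only [ne_eq, h1, h2, h3, h4, hq', BlockType.Valid, equalPos, equalNeg, true_imp_iff]
      constructor
      · intro h
        by_cases h0 : 0 < u
        · exact Or.inl ⟨u, by omega⟩
        · exact Or.inr ⟨-u, by omega⟩
      · rintro (⟨b, hb⟩ | ⟨b, hb⟩) <;> omega) (by
      intro b b'
      simp only [BlockType.Valid, equalPos, equalNeg, true_imp_iff]
      omega)

lemma ncard_restriction_diff_one (hst : s < t) (he : e = 0 ∨ e = 1)
    (hτ : τ = 2 * S + 1 - e) (hq : (q : ℤ) = τ + 2 * m - 6) (hS : 4 ≤ S) :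
    ((restrictionComplement (shiD m) (diffHyperplane s t 1) q).ncard : ℤ) =
      ((S - 2) * classProd s t (τ - 4) (τ - 3) (τ - 4)) +
      ((S - 1 - e) * classProd s t (τ - 4) (τ - 3) (τ - 4)) := by
  have hst' : (s : ℕ) < t := hst
  have htm := t.2
  have hq' : (q : ℤ) = 2 * (S + (m - 2)) - 1 - e := by omega
  rw [← ncard_succPos hst he hτ (by omega), ← ncard_succNeg hst he hτ (by omega)]
  exact_mod_cast ncard_eq_add_of_blockTypes hst hq' he (by omega) _
    (fun x y => x - y = ((1 : ℤ) : ZMod q) ∧ x - y ≠ ((1 - 1 : ℤ) : ZMod q) ∧ x + y ≠ 0 ∧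
      x + y ≠ 1)
    (fun x => mem_restrictionComplement_diff hst (Or.inr rfl))
    (succPos hst S e he) (succNeg hst S e he) rfl rfl rfl rfl (by
      intro u v hu hv
      have h1 := intCast_sub_eq_iff hq' hu hv (c := 1) (Or.inr rfl)
      have h2 := intCast_sub_eq_iff hq' hu hv (c := 1 - 1) (Or.inl rfl)
      have h3 := intCast_add_eq_iff hq' he (by omega) hu hv (Or.inl rfl)
      have h4 := intCast_add_eq_iff hq' he (by omega) hu hv (Or.inr rfl)
      rw [Int.cast_zero] at h3
      rw [Int.cast_one] at h4
      unfold InRange at hu hv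
      simp only [ne_eq, h1, h2, h3, h4, hq', BlockType.Valid, succPos, succNeg, true_imp_iff,
        false_imp_iff, and_true, true_and]
      constructor
      · intro h
        by_cases h0 : 0 < v
        · exact Or.inl ⟨v, by omega⟩
        · exact Or.inr ⟨-u, by omega⟩
      · rintro (⟨b, hb⟩ | ⟨b, hb⟩) <;> omega) (by
      intro b b'
      simp only [BlockType.Valid, succPos, succNeg, true_imp_iff, false_imp_iff, and_true, true_and]
      omega)

lemma ncard_restriction_sum_zero (hst : s < t) (he : e = 0 ∨ e = 1)
    (hτ : τ = 2 * S + 1 - e) (hq : (q : ℤ) = τ + 2 * m - 6) (hS : 4 ≤ S) :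
    ((restrictionComplement (shiD m) (sumHyperplane s t 0) q).ncard : ℤ) =
      ((S - 1 - e) * classProd s t (τ - 2) (τ - 3) (τ - 4)) +
      ((S - 1 - e) * classProd s t (τ - 2) (τ - 3) (τ - 4) -
        if e = 1 then 0 else classProd s t (τ - 3) (τ - 3) (τ - 4)) := by
  have hst' : (s : ℕ) < t := hst
  have htm := t.2
  have hq' : (q : ℤ) = 2 * (S + (m - 2)) - 1 - e := by omega
  rw [← ncard_oppositeNeg hst he hτ (by omega), ← ncard_oppositePos hst he hτ (by omega)]
  exact_mod_cast ncard_eq_add_of_blockTypes hst hq' he (by omega) _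
    (fun x y => x + y = ((0 : ℤ) : ZMod q) ∧ x + y ≠ ((1 - 0 : ℤ) : ZMod q) ∧ x - y ≠ 0 ∧
      x - y ≠ 1)
    (fun x => mem_restrictionComplement_sum hst (Or.inl rfl))
    (oppositePos hst S e he) (oppositeNeg hst S e he) rfl rfl rfl rfl (by
      intro u v hu hv
      have h1 := intCast_add_eq_iff hq' he (by omega) hu hv (c := 0) (Or.inl rfl)
      have h2 := intCast_add_eq_iff hq' he (by omega) hu hv (c := 1 - 0) (Or.inr rfl)
      have h3 := intCast_sub_eq_iff hq' hu hv (Or.inl rfl)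
      have h4 := intCast_sub_eq_iff hq' hu hv (Or.inr rfl)
      rw [Int.cast_zero] at h3
      rw [Int.cast_one] at h4
      unfold InRange at hu hv
      simp only [ne_eq, h1, h2, h3, h4, hq', BlockType.Valid, oppositePos, oppositeNeg,
        true_imp_iff]
      constructor
      · intro h
        by_cases h0 : 0 < u
        · exact Or.inl ⟨u, by omega⟩
        · exact Or.inr ⟨v, by omega⟩
      · rintro (⟨b, hb⟩ | ⟨b, hb⟩) <;> omega) (by
      intro b b'
      simp only [BlockType.Valid, oppositePos, oppositeNeg, true_imp_iff]
      omega)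

lemma ncard_restriction_sum_one (hst : s < t) (he : e = 0 ∨ e = 1)
    (hτ : τ = 2 * S + 1 - e) (hq : (q : ℤ) = τ + 2 * m - 6) (hS : 4 ≤ S) :
    ((restrictionComplement (shiD m) (sumHyperplane s t 1) q).ncard : ℤ) =
      ((S - 1) * classProd s t (τ - 4) (τ - 3) (τ - 2) - classProd s t (τ - 4) (τ - 3) (τ - 3)) +
      ((S - 1) * classProd s t (τ - 4) (τ - 3) (τ - 2) -
        if e = 1 then classProd s t (τ - 4) (τ - 3) (τ - 3) else 0) := by
  have hst' : (s : ℕ) < t := hst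
  have htm := t.2
  have hq' : (q : ℤ) = 2 * (S + (m - 2)) - 1 - e := by omega
  rw [← ncard_sumOnePos hst he hτ (by omega), ← ncard_sumOneNeg hst he hτ (by omega)]
  exact_mod_cast ncard_eq_add_of_blockTypes hst hq' he (by omega) _
    (fun x y => x + y = ((1 : ℤ) : ZMod q) ∧ x + y ≠ ((1 - 1 : ℤ) : ZMod q) ∧ x - y ≠ 0 ∧
      x - y ≠ 1)
    (fun x => mem_restrictionComplement_sum hst (Or.inr rfl))
    (sumOnePos hst S e he) (sumOneNeg hst S e he) rfl rfl rfl rfl (by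
      intro u v hu hv
      have h1 := intCast_add_eq_iff hq' he (by omega) hu hv (c := 1) (Or.inr rfl)
      have h2 := intCast_add_eq_iff hq' he (by omega) hu hv (c := 1 - 1) (Or.inl rfl)
      have h3 := intCast_sub_eq_iff hq' hu hv (Or.inl rfl)
      have h4 := intCast_sub_eq_iff hq' hu hv (Or.inr rfl)
      rw [Int.cast_zero] at h3
      rw [Int.cast_one] at h4
      unfold InRange at hu hv
      simp only [ne_eq, h1, h2, h3, h4, hq', BlockType.Valid, sumOnePos, sumOneNeg, true_imp_iff,
        false_imp_iff, and_true, true_and]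
      constructor
      · intro h
        by_cases h0 : 0 < u
        · exact Or.inl ⟨-v, by omega⟩
        · exact Or.inr ⟨-u, by omega⟩
      · rintro (⟨b, hb⟩ | ⟨b, hb⟩) <;> omega) (by
      intro b b'
      simp only [BlockType.Valid, sumOnePos, sumOneNeg, true_imp_iff, false_imp_iff, and_true,
        true_and]
      omega)

end Restrictions

/-! ### The counts in terms of `T` -/

/-- The exponents of `classProd` for `i = p + 1`, `j = p + d + 2` and `m = j + r`. -/
lemma cast_classProd {m p d r : ℕ} {s t : Fin m} (hs : (s : ℕ) = p) (ht : (t : ℕ) = p + d + 1)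
    (hm : m = p + d + r + 2) (x y z : ℤ) :
    ((classProd s t x y z : ℤ) : ℚ) = (x : ℚ) ^ p * (y : ℚ) ^ d * (z : ℚ) ^ r := by
  unfold classProd
  rw [hs, ht, show p + d + 1 - p - 1 = d by omega, show m - 1 - (p + d + 1) = r by omega]
  push_cast
  ring

theorem theorem1p6 (m i j : ℕ) (hi : 1 ≤ i) (hij : i < j) (hjm : j ≤ m) :
    -- `s` and `t` are the `i`-th and the `j`-th of the `m` coordinates
    let s : Fin m := ⟨i - 1, by omega⟩
    let t : Fin m := ⟨j - 1, by omega⟩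
    ∀ᶠ q : ℕ in Filter.atTop,
      let T : ℚ := (q : ℚ) - 2 * (m : ℚ)
      -- restriction to `x_i - x_j = 0`
      ((Odd q →
          ((restrictionComplement (shiD m) (diffHyperplane s t 0) q).ncard : ℚ) =
            (T + 3) ^ (j - i - 1) * (T + 4) ^ (m - j) * ((T + 4) ^ i - (T + 3) ^ (i - 1))
              - (T + 3) ^ (m - i - 1) * (T + 4) ^ (i - 1)) ∧
        (Even q →
          ((restrictionComplement (shiD m) (diffHyperplane s t 0) q).ncard : ℚ) =
            (T + 3) ^ (j - i - 1) * (T + 4) ^ (i - 1)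
                * ((T + 4) ^ (m - j + 1) - (T + 3) ^ (m - j))
              - (T + 3) ^ (m - i - 1) * (T + 4) ^ (i - 1))) ∧
      -- restriction to `x_i - x_j = 1`
      ((restrictionComplement (shiD m) (diffHyperplane s t 1) q).ncard : ℚ) =
        (T + 2) ^ (m + i - j) * (T + 3) ^ (j - i - 1) ∧
      -- restriction to `x_i + x_j = 0`; the exponent `i - 2` is an integer, equal to `-1` for `i = 1`
      ((Odd q →
          ((restrictionComplement (shiD m) (sumHyperplane s t 0) q).ncard : ℚ) =
            (T + 2) ^ (m - j) * (T + 3) ^ (j - i)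
              * ((T + 4) ^ (i - 1) - (T + 3) ^ ((i : ℤ) - 2))) ∧
        (Even q →
          ((restrictionComplement (shiD m) (sumHyperplane s t 0) q).ncard : ℚ) =
            (T + 2) ^ (m - j + 1) * (T + 3) ^ (j - i - 1) * (T + 4) ^ (i - 1))) ∧
      -- restriction to `x_i + x_j = 1`
      ((Odd q →
          ((restrictionComplement (shiD m) (sumHyperplane s t 1) q).ncard : ℚ) =
            (T + 2) ^ (i - 1) * (T + 3) ^ (j - i) * (T + 4) ^ (m - j)
              - (T + 2) ^ (i - 1) * (T + 3) ^ (m - i - 1)) ∧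
        (Even q →
          ((restrictionComplement (shiD m) (sumHyperplane s t 1) q).ncard : ℚ) =
            (T + 2) ^ (i - 1) * (T + 3) ^ (j - i - 1)
                * ((T + 4) ^ (m - j + 1) - (T + 3) ^ (m - j))
              - (T + 2) ^ (i - 1) * (T + 3) ^ (m - i - 1))) := by

  intro s t
  filter_upwards [Filter.eventually_ge_atTop (2 * m + 10)] with q hq T
  obtain ⟨p, rfl⟩ : ∃ p, i = p + 1 := ⟨i - 1, by omega⟩
  obtain ⟨d, rfl⟩ : ∃ d, j = p + 1 + d + 1 := ⟨j - (p + 1) - 1, by omega⟩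
  obtain ⟨r, hr⟩ : ∃ r, m = p + d + r + 2 := ⟨m - (p + d + 2), by omega⟩
  have hst : s < t := by
    simp only [s, t, Fin.mk_lt_mk]; omega
  have hcast := fun x y z => cast_classProd (m := m) (p := p) (d := d) (r := r) (s := s) (t := t)
    (by simp [s]) (by simp only [t]; omega) hr x y z
  rw [show p + 1 + d + 1 - (p + 1) - 1 = d by omega, show m - (p + 1 + d + 1) = r by omega,
    show m - (p + 1) - 1 = d + r by omega, show m + (p + 1) - (p + 1 + d + 1) = p + r + 1 by omega,
    show p + 1 + d + 1 - (p + 1) = d + 1 by omega, Nat.add_sub_cancel]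
  have hT : T + 3 ≠ 0 := by
    have : (2 * m + 10 : ℚ) ≤ q := by exact_mod_cast hq
    simp only [T]
    linarith
  have hz : (T + 3) ^ (((p + 1 : ℕ) : ℤ) - 2) = (T + 3) ^ p / (T + 3) := by
    rw [show (((p + 1 : ℕ) : ℤ) - 2) = (p : ℤ) - 1 by push_cast; ring, zpow_sub_one₀ hT,
      zpow_natCast, div_eq_mul_inv]
  rw [hz]
  have hτ : ((((q : ℤ) - 2 * m + 6 : ℤ)) : ℚ) = T + 6 := by simp [T]
  -- The half-line has `S + (m - 2)` positions: `(q + 1) / 2` for odd and `q / 2 + 1` for even `q`.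
  obtain ⟨S, e, he, hS, hSe⟩ : ∃ S e : ℤ, (e = 0 ∨ e = 1) ∧ (q : ℤ) - 2 * m + 6 = 2 * S + 1 - e ∧
      (e = 0 ↔ Odd q) := by
    rcases Nat.even_or_odd' q with ⟨k, rfl | rfl⟩
    · exact ⟨k - m + 3, 1, Or.inr rfl, by push_cast; ring, by simp⟩
    · exact ⟨k - m + 3, 0, Or.inl rfl, by push_cast; ring, by simp⟩
  have hq' : (q : ℤ) = ((q : ℤ) - 2 * m + 6) + 2 * m - 6 := by ring
  have hSQ : (S : ℚ) = (T + 5 + e) / 2 := by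
    have : (((q : ℤ) - 2 * m + 6 : ℤ) : ℚ) = ((2 * S + 1 - e : ℤ) : ℚ) := by rw [hS]
    rw [hτ] at this
    push_cast at this
    linarith
  have k1 := congrArg (Int.cast : ℤ → ℚ) (ncard_restriction_diff_zero hst he hS hq' (by omega))
  have k2 := congrArg (Int.cast : ℤ → ℚ) (ncard_restriction_diff_one hst he hS hq' (by omega))
  have k3 := congrArg (Int.cast : ℤ → ℚ) (ncard_restriction_sum_zero hst he hS hq' (by omega))
  have k4 := congrArg (Int.cast : ℤ → ℚ) (ncard_restriction_sum_one hst he hS hq' (by omega))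
  generalize (q : ℤ) - 2 * m + 6 = τ at *
  push_cast [hcast, hτ, apply_ite (Int.cast : ℤ → ℚ)] at k1 k2 k3 k4
  rw [k1, k2, k3, k4, hSQ]
  have odd : Odd q → e = 0 := hSe.2
  have even : Even q → e = 1 := fun h =>
    he.resolve_left fun h0 => Nat.not_odd_iff_even.2 h (hSe.1 h0)
  refine ⟨⟨fun h => ?_, fun h => ?_⟩, ?_, ⟨fun h => ?_, fun h => ?_⟩, ⟨fun h => ?_, fun h => ?_⟩⟩
  · rw [odd h]
    simp only [zero_ne_one, if_false]
    ring
  · rw [even h]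
    simp only [if_true]
    ring
  · ring
  · rw [odd h]
    simp only [zero_ne_one, if_false]
    field_simp
    ring
  · rw [even h]
    simp only [if_true]
    ring
  · rw [odd h]
    simp only [zero_ne_one, if_false]
    ring
  · rw [even h]
    simp only [if_true]
    ring
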